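/- Let $n\ge 0$ and let $W=\mathbb C^{n+1}$ have basis $w_1,\dots,w_{n+1}$; let $pr_k:W\to W$ kill $w_k$ and fix the other basis vectors. The degenerate flag variety $\mathcal F^a_{n+1}$ is the variety of collections $(V_1,\dots,V_n)$ of subspaces of $W$ with $\dim V_k=k$ and $pr_{k+1}V_k\subset V_{k+1}$ for $1\le k\le n-1$. Equivalently, it is the quiver Grassmannian of subrepresentations of dimension $(1,\dots,n)$ of the representation $M$ of the quiver $1\to 2\to\dots\to n$ that has the space $W$ at every vertex and the map $pr_{k+1}$ on the arrow $k\to k+1$. Write $M=R_1\oplus\dots\oplus R_{2n}$, where for $i\le n$ the indecomposable summand $R_i$ is spanned by $w_{n+1-i}$ at each of the vertices $n+1-i,\dots,n$, and for $i>n$ it is spanned by $w_{2n+2-i}$ at each of the vertices $1,\dots,2n+1-i$. The torus $T=(\mathbb C^*)^{2n}$ acts on $M$, and hence on $\mathcal F^a_{n+1}$, its $i$-th factor scaling $R_i$. A collection ${\bf S}=(S_1,\dots,S_n)$ of subsets of $\{1,\dots,n+1\}$ is admissible if $\#S_k=k$ for all $k$ and $S_k\subset S_{k+1}\cup\{k+1\}$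 for $1\le k\le n-1$; then $p_{\bf S}\in\mathcal F^a_{n+1}$ is the $T$-fixed point with $V_k=\mathrm{span}(w_a:\ a\in S_k)$. For $1\le i<j\le 2n$ the pair $(i,j)$ is ${\bf S}$-effective if $\dim\mathrm{Hom}(R_i,R_j)=1$, $p_{\bf S}\cap R_i\neq 0$ and $\gamma(p_{\bf S}\cap R_i)\not\subset p_{\bf S}$ for $0\ne\gamma\in\mathrm{Hom}(R_i,R_j)$. Put $U_{i,j}=\{\exp\gamma:\ \gamma\in\mathrm{Hom}(R_i,R_j)\}\subset\mathrm{Aut}(M)$, where $\mathrm{Hom}(R_i,R_j)\subset\mathrm{End}(M)$ via the decomposition of $M$. Let $\mathfrak t$ be the space of diagonal traceless $2n\times 2n$ matrices, regarded as the Lie algebra of $T$ modulo the scalars (which act trivially), and let $\alpha_{i,j}\in\mathfrak t^*$ be $\alpha_{i,j}(\mathrm{diag}(x_1,\dots,x_{2n}))=x_i-x_j$. The moment graph of $\mathcal F^a_{n+1}$ has the $T$-fixed points as vertices. A one-dimensional $T$-orbit $L$ is an edge between the vertices $p\ne q$ if $\overline L=L\sqcup\{p\}\sqcup\{q\}$,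 and a label of $L$ is a non-zero element of the annihilator in $\mathfrak t^*$ of the Lie algebra $\mathfrak t_x\subset\mathfrak t$ of the stabilizer of a point $x\in L$ (this $\mathfrak t_x$ is a hyperplane for every $x\in L$). **Theorem.** The number of one-dimensional $T$-orbits in $\mathcal F^a_{n+1}$ is finite. The one-dimensional $T$-orbits are exactly the sets $U_{i,j}p_{\bf S}\setminus\{p_{\bf S}\}$, where ${\bf S}$ is admissible and $(i,j)$ is ${\bf S}$-effective. For every such ${\bf S}$ and $(i,j)$, the orbit $U_{i,j}p_{\bf S}\setminus\{p_{\bf S}\}$ is an edge of the moment graph between $p_{\bf S}$ and another $T$-fixed point, and this edge is labeled by $\alpha_{i,j}$. -/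

import Mathlib

/-!
All indices are shifted by one with respect to the usual numbering: the vertices `1, …, n` of the
quiver are `Fin n`, the basis vectors `w_1, …, w_{n+1}` are indexed by `Fin (n + 1)`, and the
indecomposable summands `R_1, …, R_{2n}` are indexed by `Fin (2 * n)`.
-/

noncomputable section

namespace DegenerateFlag

/-! ### The degenerate flag variety -/

/-- The vector space `W = ℂ^(n+1)`. -/
abbrev W (n : ℕ) : Type := Fin (n + 1) → ℂ

/-- The standard basis vector `w_a` of `W`. -/
def w {n : ℕ} (a : Fin (n + 1)) : W n := Pi.single a 1

/-- The projection `pr_a : W → W` that kills `w_a` and fixes the other basis vectors. -/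
def pr {n : ℕ} (a : Fin (n + 1)) : W n →ₗ[ℂ] W n where
  toFun v := fun b => if b = a then 0 else v b
  map_add' u v := by
    funext b
    by_cases h : b = a <;> simp [h]
  map_smul' c v := by
    funext b
    by_cases h : b = a <;> simp [h]

/-- The degenerate flag variety `F^a_{n+1}`: collections `(V_1, …, V_n)` of subspaces of `W` with
`dim V_k = k` and `pr_{k+1} V_k ⊆ V_{k+1}`.  (With shifted indices, for the arrow from `k` to
`l = k + 1`, the vector killed is the one with index `l`.)  Equivalently: the subrepresentations of
dimension `(1, …, n)` of the quiver representation `M = P ⊕ I` that has the space `W` at each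
vertex and the map `pr_{k+1}` on the arrow `k → k + 1`. -/
@[ext]
structure DegFlag (n : ℕ) where
  /-- the underlying collection of subspaces -/
  V : Fin n → Submodule ℂ (W n)
  finrank_eq : ∀ k, Module.finrank ℂ (V k) = (k : ℕ) + 1
  map_le : ∀ k l : Fin n, (l : ℕ) = (k : ℕ) + 1 → (V k).map (pr l.castSucc) ≤ V l

/-- The automorphism group of the quiver representation `M = P ⊕ I`. -/
def autM (n : ℕ) : Subgroup (Fin n → W n ≃ₗ[ℂ] W n) where
  carrier := {g | ∀ k l : Fin n, (l : ℕ) = (k : ℕ) + 1 →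
    ∀ v, g l (pr l.castSucc v) = pr l.castSucc (g k v)}
  mul_mem' {g h} hg hh k l hkl v := by
    simp only [Pi.mul_apply, LinearEquiv.mul_apply]
    rw [hh k l hkl, hg k l hkl]
  one_mem' k l hkl v := rfl
  inv_mem' {g} hg k l hkl v := by
    change (g l).symm (pr l.castSucc v) = pr l.castSucc ((g k).symm v)
    rw [LinearEquiv.symm_apply_eq, hg k l hkl, LinearEquiv.apply_symm_apply]

/-- `Aut M` acts on the degenerate flag variety: `(g V)_k = g_k (V_k)`. -/
instance (n : ℕ) : MulAction (autM n) (DegFlag n) where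
  smul g x :=
    { V := fun k => (x.V k).map ((g.1 k : W n ≃ₗ[ℂ] W n) : W n →ₗ[ℂ] W n)
      finrank_eq := fun k => by
        rw [← x.finrank_eq k]
        exact LinearEquiv.finrank_map_eq (g.1 k) (x.V k)
      map_le := fun k l hkl => by
        rintro _ ⟨_, ⟨v, hv, rfl⟩, rfl⟩
        exact ⟨pr l.castSucc v, x.map_le k l hkl ⟨v, hv, rfl⟩, g.2 k l hkl v⟩ }
  one_smul x := by
    apply DegFlag.ext
    funext k
    exact Submodule.map_id (x.V k)
  mul_smul g h x := by
    apply DegFlag.ext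
    funext k
    exact Submodule.map_comp _ _ (x.V k)

/-! ### The indecomposable summands and the torus -/

/-- The index `i` of the indecomposable summand `R_i` of `M = P ⊕ I` that contains the basis vector
`w_a` of the space `W` at the vertex `k`.  In the usual numbering, `R_i` for `i ≤ n` is spanned by
`w_{n+1-i}` at the last `i` vertices (so `w_a` at the vertices `k ≥ a` lies in `R_{n+1-a} = P_a`),
and `R_i` for `i > n` is spanned by `w_{2n+2-i}` at the first `2n+1-i` vertices (so `w_a` at the
vertices `k < a` lies in `R_{2n+2-a} = I_{a-1}`). -/
def summand {n : ℕ} (k : Fin n) (a : Fin (n + 1)) : Fin (2 * n) :=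
  if h : (a : ℕ) ≤ (k : ℕ) then ⟨n - 1 - a, by omega⟩ else ⟨2 * n - a, by omega⟩

/-- The space `(R_i)_k ⊆ W` of the summand `R_i` at the vertex `k`. -/
def R {n : ℕ} (i : Fin (2 * n)) (k : Fin n) : Submodule ℂ (W n) :=
  Submodule.span ℂ {v | ∃ a, summand k a = i ∧ v = w a}

theorem summand_eq_of_ne {n : ℕ} {k l : Fin n} (hkl : (l : ℕ) = (k : ℕ) + 1) {a : Fin (n + 1)}
    (ha : a ≠ l.castSucc) : summand k a = summand l a := by
  have h : (a : ℕ) ≠ (l : ℕ) := fun h => ha (Fin.ext h)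
  unfold summand
  split_ifs <;> first | rfl | omega

/-- The torus `T = (ℂ^*)^{2n}` as automorphisms of `M`: the `i`-th coordinate of `t` scales the
summand `R_i`. -/
def torus (n : ℕ) : (Fin (2 * n) → ℂˣ) →* autM n where
  toFun t :=
    ⟨fun k => LinearEquiv.piCongrRight fun a => LinearEquiv.smulOfUnit (t (summand k a)), by
      intro k l hkl v
      funext a
      by_cases ha : a = l.castSucc
      · subst ha
        simp [pr, LinearEquiv.smulOfUnit]
      · simp [pr, LinearEquiv.smulOfUnit, ha, summand_eq_of_ne hkl ha]⟩
  map_one' := by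
    apply Subtype.ext
    funext k
    ext v a
    simp [LinearEquiv.smulOfUnit]
  map_mul' s t := by
    apply Subtype.ext
    funext k
    ext v a
    simp [LinearEquiv.smulOfUnit, mul_smul]

/-- The `T`-orbit of a point. -/
def orbit {n : ℕ} (x : DegFlag n) : Set (DegFlag n) :=
  Set.range fun t : Fin (2 * n) → ℂˣ => torus n t • x

/-- The exponential map `ℂ^{2n} → T` of the torus. -/
def expT {n : ℕ} (X : Fin (2 * n) → ℂ) : Fin (2 * n) → ℂˣ :=
  fun i => Units.mk0 (Complex.exp (X i)) (Complex.exp_ne_zero _)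

theorem expT_add {n : ℕ} (X Y : Fin (2 * n) → ℂ) : expT (X + Y) = expT X * expT Y := by
  funext i
  ext
  simp [expT, Complex.exp_add]

theorem expT_zero {n : ℕ} : expT (0 : Fin (2 * n) → ℂ) = 1 := by
  funext i
  ext
  simp [expT]

/-- The Lie algebra of the stabilizer `T_x ⊆ T` of the point `x`, inside `Lie T = ℂ^{2n}`: all `X`
with `exp (s X) ∈ T_x` for all `s`. -/
def lieStab {n : ℕ} (x : DegFlag n) : Submodule ℂ (Fin (2 * n) → ℂ) where
  carrier := {X | ∀ s : ℂ, torus n (expT (s • X)) • x = x}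
  add_mem' {X Y} hX hY s := by
    rw [smul_add, expT_add, map_mul, mul_smul, hY s, hX s]
  zero_mem' s := by
    rw [smul_zero, expT_zero, map_one, one_smul]
  smul_mem' c X hX s := by
    rw [smul_smul]
    exact hX (s * c)

/-- `L` is a `T`-orbit of dimension one.  The dimension of the orbit of `x`, which is isomorphic to
the homogeneous space `T / T_x`, is `dim Lie T - dim Lie T_x`. -/
def IsOneDimOrbit {n : ℕ} (L : Set (DegFlag n)) : Prop :=
  ∃ x, L = orbit x ∧
    Module.finrank ℂ (Fin (2 * n) → ℂ) = Module.finrank ℂ (lieStab x) + 1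

/-- `x` is a fixed point of the torus. -/
def IsTFixed {n : ℕ} (x : DegFlag n) : Prop := ∀ t, torus n t • x = x

/-! ### Admissible collections and the fixed points `p_S` -/

/-- A collection `S = (S_1, …, S_n)` of subsets of `{1, …, n+1}` with `#S_k = k` and
`S_k ⊆ S_{k+1} ∪ {k+1}`. -/
structure Admissible (n : ℕ) where
  /-- the underlying collection of subsets -/
  S : Fin n → Finset (Fin (n + 1))
  card_eq : ∀ k, (S k).card = (k : ℕ) + 1
  subset : ∀ k l : Fin n, (l : ℕ) = (k : ℕ) + 1 → S k ⊆ S l ∪ {l.castSucc}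

/-- The point `p_S = (V_1, …, V_n)` with `V_k = span (w_a, a ∈ S_k)`. -/
def Admissible.p {n : ℕ} (S : Admissible n) : DegFlag n where
  V k := Submodule.span ℂ (w '' (S.S k : Set (Fin (n + 1))))
  finrank_eq k := by
    have hli : LinearIndependent ℂ (w : Fin (n + 1) → W n) := by
      have h := (Pi.basisFun ℂ (Fin (n + 1))).linearIndependent
      have e : (⇑(Pi.basisFun ℂ (Fin (n + 1))) : Fin (n + 1) → W n) = w := by
        funext a
        simp [w]
      rwa [e] at h
    have h2 := finrank_span_finset_eq_card (R := ℂ) (s := (S.S k).image w) (by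
      have := (hli.comp (Subtype.val : (S.S k) → Fin (n + 1)) Subtype.val_injective)
      rw [Finset.coe_image]
      exact LinearIndepOn.id_image this)
    rw [Finset.coe_image] at h2
    rw [h2, Finset.card_image_of_injective _ hli.injective, S.card_eq]
  map_le k l hkl := by
    rw [Submodule.map_span, Submodule.span_le]
    rintro _ ⟨_, ⟨a, ha, rfl⟩, rfl⟩
    by_cases h : a = l.castSucc
    · have e : pr l.castSucc (w a : W n) = 0 := by
        subst h
        funext b
        by_cases hb : b = l.castSucc <;> simp [pr, w, hb]
      rw [e]
      exact Submodule.zero_mem _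
    · have e : pr l.castSucc (w a : W n) = w a := by
        funext b
        by_cases hb : b = l.castSucc
        · subst hb
          simp [pr, w, Ne.symm h]
        · simp [pr, hb]
      rw [e]
      refine Submodule.subset_span ⟨a, ?_, rfl⟩
      have := S.subset k l hkl ha
      simpa [h] using this

/-! ### One-parameter subgroups and effective pairs -/

/-- `Hom (R_i, R_j)`, viewed inside `End M` through the decomposition `M = R_1 ⊕ ⋯ ⊕ R_{2n}`: the
endomorphisms of the representation `M` that map `R_i` into `R_j` and vanish on the other summands.
For `i < j` this is the summand `𝔞_{i,j}` of the Lie algebra `𝔞`. -/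
def homR {n : ℕ} (i j : Fin (2 * n)) : Submodule ℂ (Fin n → Module.End ℂ (W n)) where
  carrier := {f |
    (∀ k l : Fin n, (l : ℕ) = (k : ℕ) + 1 → ∀ v, f l (pr l.castSucc v) = pr l.castSucc (f k v)) ∧
    (∀ k, ∀ v ∈ R i k, f k v ∈ R j k) ∧
    (∀ k, ∀ m, m ≠ i → ∀ v ∈ R m k, f k v = 0)}
  add_mem' {f g} hf hg := by
    refine ⟨fun k l hkl v => ?_, fun k v hv => ?_, fun k m hm v hv => ?_⟩
    · simp [hf.1 k l hkl v, hg.1 k l hkl v]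
    · exact Submodule.add_mem _ (hf.2.1 k v hv) (hg.2.1 k v hv)
    · simp [hf.2.2 k m hm v hv, hg.2.2 k m hm v hv]
  zero_mem' := by
    refine ⟨fun k l hkl v => ?_, fun k v hv => ?_, fun k m hm v hv => ?_⟩ <;> simp
  smul_mem' c f hf := by
    refine ⟨fun k l hkl v => ?_, fun k v hv => ?_, fun k m hm v hv => ?_⟩
    · simp [hf.1 k l hkl v]
    · exact Submodule.smul_mem _ c (hf.2.1 k v hv)
    · simp [hf.2.2 k m hm v hv]

/-- The one-parameter subgroup `U_{i,j}` with Lie algebra `𝔞_{i,j} = Hom (R_i, R_j)`, for `i < j`: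
the automorphisms `exp γ` of `M` with `γ ∈ Hom (R_i, R_j)` (these `γ` are nilpotent). -/
def U {n : ℕ} (i j : Fin (2 * n)) : Set (autM n) :=
  {g | ∃ γ ∈ homR i j, ∀ k, ((g.1 k : W n ≃ₗ[ℂ] W n) : W n →ₗ[ℂ] W n) = IsNilpotent.exp (γ k)}

/-- The pair `(i, j)` is `S`-effective: `i < j` (so that `Hom (R_i, R_j)` is part of `𝔞`),
`dim Hom (R_i, R_j) = 1`, and, for `γ` a non-zero element of this space, `p_S ∩ R_i ≠ 0` and
`γ (p_S ∩ R_i)` is not contained in `p_S`. -/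
def IsEffective {n : ℕ} (S : Admissible n) (i j : Fin (2 * n)) : Prop :=
  i < j ∧ Module.finrank ℂ (homR i j) = 1 ∧
    (∃ k, S.p.V k ⊓ R i k ≠ ⊥) ∧
    ∀ γ ∈ homR i j, γ ≠ 0 → ¬ ∀ k, (S.p.V k ⊓ R i k).map (γ k) ≤ S.p.V k

/-- The set `U_{i,j} p_S ∖ p_S`. -/
def curve {n : ℕ} (S : Admissible n) (i j : Fin (2 * n)) : Set (DegFlag n) :=
  ((fun g : autM n => g • S.p) '' U i j) \ {S.p}

/-! ### The moment graph -/

/-- Index set for the entries of a tuple of matrices of sizes `(n+1) × k`, `k = 1, …, n`. -/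
abbrev FrameIdx (n : ℕ) : Type := Σ k : Fin n, Fin (n + 1) × Fin ((k : ℕ) + 1)

/-- The frames of a point `x = (V_1, …, V_n)`: tuples of `(n+1) × k` matrices whose columns form a
basis of `V_k` (the columns span `V_k`, and their number is `dim V_k`). -/
def frames {n : ℕ} (x : DegFlag n) : Set (FrameIdx n → ℂ) :=
  {B | ∀ k : Fin n, Submodule.span ℂ (Set.range fun q : Fin ((k : ℕ) + 1) =>
    (fun a => B ⟨k, a, q⟩ : W n)) = x.V k}

/-- The Zariski closure of `L` in the degenerate flag variety.  The product of Grassmannians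
carries the quotient of the Zariski topology on tuples of matrices of full rank, so that `x` lies in
the closure of `L` if and only if each polynomial in the matrix entries that vanishes on all frames
of all points of `L` vanishes on the frames of `x`. -/
def zariskiClosure {n : ℕ} (L : Set (DegFlag n)) : Set (DegFlag n) :=
  {x | frames x ⊆ MvPolynomial.zeroLocus ℂ (MvPolynomial.vanishingIdeal ℂ (⋃ y ∈ L, frames y))}

/-- The one-dimensional orbit `L` is an edge of the moment graph between the vertices (fixed points)
`p` and `q`: the closure of `L` is the disjoint union of `L`, `{p}` and `{q}`. -/
structure IsMomentEdge {n : ℕ} (L : Set (DegFlag n)) (p q : DegFlag n) : Prop where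
  isOneDimOrbit : IsOneDimOrbit L
  fixed_left : IsTFixed p
  fixed_right : IsTFixed q
  ne : p ≠ q
  left_notMem : p ∉ L
  right_notMem : q ∉ L
  closure_eq : zariskiClosure L = L ∪ {p, q}

/-- The Lie algebra `𝔱`: the diagonal traceless `2n × 2n` matrices. -/
def traceless (n : ℕ) : Submodule ℂ (Fin (2 * n) → ℂ) where
  carrier := {X | ∑ i, X i = 0}
  add_mem' {X Y} hX hY := by
    simp only [Set.mem_ofPred_eq, Pi.add_apply, Finset.sum_add_distrib] at *
    rw [hX, hY, add_zero]
  zero_mem' := by simp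
  smul_mem' c X hX := by
    simp only [Set.mem_ofPred_eq, Pi.smul_apply, ← Finset.smul_sum] at *
    rw [hX, smul_zero]

/-- The Lie algebra `𝔱_x ⊆ 𝔱` of the stabilizer of `x`. -/
def tStab {n : ℕ} (x : DegFlag n) : Submodule ℂ (traceless n) :=
  (lieStab x).comap (traceless n).subtype

/-- The linear form `α_{i,j} (diag (x_1, …, x_{2n})) = x_i - x_j` on `𝔱`. -/
def alpha {n : ℕ} (i j : Fin (2 * n)) : Module.Dual ℂ (traceless n) where
  toFun X := X.1 i - X.1 j
  map_add' X Y := by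
    simp only [Submodule.coe_add, Pi.add_apply]
    ring
  map_smul' c X := by
    simp only [Submodule.coe_smul, Pi.smul_apply, smul_eq_mul, RingHom.id_apply]
    ring

/-- `α` is a label of the edge `L` of the moment graph: for `x ∈ L` the Lie algebra `𝔱_x` is a
hyperplane in `𝔱`, and `α` is a non-zero element of its annihilator. -/
def IsEdgeLabel {n : ℕ} (L : Set (DegFlag n)) (α : Module.Dual ℂ (traceless n)) : Prop :=
  α ≠ 0 ∧ ∀ x ∈ L, IsCoatom (tStab x) ∧ α ∈ (tStab x).dualAnnihilator

end DegenerateFlag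

end

open DegenerateFlag

/-!
Everything is explicit linear algebra. At each vertex `k` the nonzero `R_i` are the coordinate lines
of `W`, so `Hom (R_i, R_j)` for `i < j` is spanned by the elementary map `elem i j`, whose square is
zero, and `U_{i,j}` consists of the transvections `1 + c · elem i j` (`U_eq_range`). A pair is
effective exactly when this map moves `p_S` at some vertex (`isEffective_iff`). Then
`c ↦ exp (c γ) p_S` is injective, and `t ∈ T` multiplies the parameter `c` by `t_j / t_i`; hence the
curve is one orbit, and the Lie algebra of the stabilizer of its points is the kernel of
`X ↦ X_i - X_j`.

Conversely, let `x` have a one-dimensional orbit. The Lie algebra of its stabilizer is a hyperplane.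
If this hyperplane were not the kernel of a root, it would contain an element with distinct
coordinates, and the spaces of `x`, being sums of eigenspaces (`restrict_mem_of_mem_lieStab`), would
be coordinate subspaces, so `x` would be fixed. So it is the kernel of `X ↦ X_i - X_j` for some
`i < j`, and the spaces of `x` split into coordinate lines and a part in `R_i ⊕ R_j`. As `x` is not
fixed, this part is spanned at some vertex by a mixed vector `w_a + c w_b`, `c ≠ 0`; the structure
maps force the same slope `c` at all other vertices (`IsHomogeneousAwayFrom.mixed_vector_mem`).
Taking leading terms, with `R_i` before `R_j`, gives `S` with `x = exp (c γ) p_S`.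

For the closure of the curve, `p_S` is the limit for `c → 0`. The limit for `c → ∞` is the point
`p_{S'}`, where `S'` is `S` with the basis vector of `R_i` exchanged for that of `R_j` at the moved
vertices; that `S'` is admissible uses `i < j`, by which the overlap of the two supports begins where
`R_i` starts and ends where `R_j` ends (`ind_left_eq`, `ind_right_eq`). That there are no other
points follows from closed conditions on frames: vanishing coordinates and vanishing maximal minors
show that a point of the closure again splits into coordinate lines and a line in `R_i ⊕ R_j` at the
moved vertices, and agrees with `p_S` at the others; the slope argument above applies once more
(`zariskiClosure_curve`).
-/

noncomputable section

namespace DegenerateFlag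

variable {n : ℕ}

/-! ### Coordinates -/

theorem w_apply (a b : Fin (n + 1)) : (w a : W n) b = if b = a then 1 else 0 := by
  simp [w, Pi.single_apply]

theorem pr_apply (a : Fin (n + 1)) (v : W n) (b : Fin (n + 1)) :
    pr a v b = if b = a then 0 else v b := rfl

theorem pr_w_of_ne {a b : Fin (n + 1)} (h : a ≠ b) : pr b (w a : W n) = w a := by
  funext c
  rw [pr_apply]
  split_ifs with hc
  · subst hc
    simp [w_apply, h.symm]
  · rfl

theorem sum_smul_w (v : W n) : ∑ a, v a • (w a : W n) = v := by
  funext b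
  simp [w_apply]

theorem mem_of_forall_smul_w_mem {V : Submodule ℂ (W n)} {v : W n}
    (h : ∀ a, v a • (w a : W n) ∈ V) : v ∈ V := by
  rw [← sum_smul_w v]
  exact Submodule.sum_mem _ fun a _ => h a

theorem eq_smul_w {v : W n} {a : Fin (n + 1)} (h : ∀ b, b ≠ a → v b = 0) : v = v a • w a := by
  funext b
  by_cases hb : b = a
  · subst hb
    simp [w_apply]
  · simp [w_apply, hb, h b hb]

theorem mem_span_w_iff (A : Set (Fin (n + 1))) (v : W n) :
    v ∈ Submodule.span ℂ (w '' A) ↔ ∀ b, b ∉ A → v b = 0 := by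
  constructor
  · intro h b hb
    have hle : Submodule.span ℂ (w '' A) ≤ LinearMap.ker (LinearMap.proj b : W n →ₗ[ℂ] ℂ) := by
      rw [Submodule.span_le]
      rintro _ ⟨a, ha, rfl⟩
      have hne : b ≠ a := fun e => hb (e ▸ ha)
      simp [w_apply, hne]
    simpa using hle h
  · intro h
    refine mem_of_forall_smul_w_mem fun a => ?_
    by_cases ha : a ∈ A
    · exact Submodule.smul_mem _ _ (Submodule.subset_span ⟨a, ha, rfl⟩)
    · rw [h a ha, zero_smul]
      exact Submodule.zero_mem _

theorem linearIndependent_w : LinearIndependent ℂ (w : Fin (n + 1) → W n) := by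
  convert (Pi.basisFun ℂ (Fin (n + 1))).linearIndependent using 1
  funext a
  simp [w]

theorem finrank_span_w (s : Finset (Fin (n + 1))) :
    Module.finrank ℂ (Submodule.span ℂ ((w : _ → W n) '' s)) = s.card := by
  classical
  have h := finrank_span_finset_eq_card (R := ℂ) (s := s.image (w : _ → W n)) (by
    rw [Finset.coe_image]
    exact (linearIndependent_w.linearIndepOn (s := (s : Set (Fin (n + 1))))).id_image)
  rwa [Finset.coe_image, Finset.card_image_of_injective _ linearIndependent_w.injective] at h

theorem Admissible.mem_p_iff (S : Admissible n) (k : Fin n) (v : W n) :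
    v ∈ S.p.V k ↔ ∀ b, b ∉ S.S k → v b = 0 := by
  exact mem_span_w_iff (S.S k : Set (Fin (n + 1))) v

theorem Admissible.w_mem_p_iff (S : Admissible n) (k : Fin n) (a : Fin (n + 1)) :
    (w a : W n) ∈ S.p.V k ↔ a ∈ S.S k := by
  rw [S.mem_p_iff]
  constructor
  · intro h
    by_contra ha
    simpa [w_apply] using h a ha
  · intro h b hb
    have hne : b ≠ a := fun e => hb (e ▸ h)
    simp [w_apply, hne]

theorem DegFlag.eq_of_le {x y : DegFlag n} (h : ∀ k, x.V k ≤ y.V k) : x = y := by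
  apply DegFlag.ext
  funext k
  exact Submodule.eq_of_le_of_finrank_eq (h k) (by rw [x.finrank_eq, y.finrank_eq])

theorem DegFlag.pr_mem (x : DegFlag n) {k l : Fin n} (hkl : (l : ℕ) = (k : ℕ) + 1) {v : W n}
    (hv : v ∈ x.V k) : pr l.castSucc v ∈ x.V l :=
  x.map_le k l hkl ⟨v, hv, rfl⟩

theorem mem_smul_V_iff (g : autM n) (x : DegFlag n) (k : Fin n) (v : W n) :
    v ∈ (g • x).V k ↔ (g.1 k).symm v ∈ x.V k := by
  constructor
  · rintro ⟨u, hu, rfl⟩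
    simpa using hu
  · intro h
    exact ⟨_, h, by simp⟩

theorem torus_mem {x : DegFlag n} {k : Fin n} {v : W n} (hv : v ∈ x.V k)
    (t : Fin (2 * n) → ℂˣ) :
    (fun a => (t (summand k a) : ℂ) * v a : W n) ∈ (torus n t • x).V k :=
  ⟨v, hv, rfl⟩

/-! ### The supports of the summands -/

/-- The index `a` of the basis vector `w_a` that spans `R_i` at the vertices where `R_i` lives. -/
def ind (i : Fin (2 * n)) : Fin (n + 1) :=
  if h : (i : ℕ) < n then ⟨n - 1 - i, by omega⟩ else ⟨2 * n - i, by omega⟩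

theorem ind_val (i : Fin (2 * n)) :
    (ind i : ℕ) = if (i : ℕ) < n then n - 1 - (i : ℕ) else 2 * n - i := by
  unfold ind
  split_ifs <;> rfl

theorem summand_val (k : Fin n) (a : Fin (n + 1)) :
    (summand k a : ℕ) = if (a : ℕ) ≤ k then n - 1 - (a : ℕ) else 2 * n - a := by
  unfold summand
  split_ifs <;> rfl

/-- The vertex `k` lies in the support of the indecomposable representation `R_i`. -/
def Alive (i : Fin (2 * n)) (k : Fin n) : Prop := summand k (ind i) = i

theorem alive_iff {i : Fin (2 * n)} {k : Fin n} :
    Alive i k ↔ if (i : ℕ) < n then n - 1 - (i : ℕ) ≤ (k : ℕ) else (k : ℕ) < 2 * n - i := by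
  unfold Alive
  rw [Fin.ext_iff, summand_val, ind_val]
  have := i.2
  have := k.2
  split_ifs <;> omega

theorem summand_eq_iff {k : Fin n} {a : Fin (n + 1)} {i : Fin (2 * n)} :
    summand k a = i ↔ a = ind i ∧ Alive i k := by
  unfold Alive
  constructor
  · intro h
    have : a = ind i := by
      subst h
      rw [Fin.ext_iff, ind_val, summand_val]
      have := a.2
      have := k.2
      split_ifs <;> omega
    exact ⟨this, this ▸ h⟩
  · rintro ⟨rfl, h⟩
    exact h

theorem summand_injective (k : Fin n) : Function.Injective (summand k) := by
  intro a b h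
  exact (summand_eq_iff.1 h).1.trans (summand_eq_iff.1 (rfl : summand k b = _)).1.symm

theorem ind_ne {i j : Fin (2 * n)} (hij : i ≠ j) {k : Fin n} (hi : Alive i k) (hj : Alive j k) :
    ind i ≠ ind j := by
  intro h
  apply hij
  rw [← hi, ← hj, h]

/-- If `R_i` and `R_j` overlap at `k` but not at `k + 1`, and `i < j`, then it is `R_j` that ends
at `k`. -/
theorem ind_right_eq {i j : Fin (2 * n)} (hij : i < j) {k l : Fin n} (hkl : (l : ℕ) = (k : ℕ) + 1)
    (hi : Alive i k) (hj : Alive j k) (h : ¬ (Alive i l ∧ Alive j l)) : ind j = l.castSucc := by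
  rw [alive_iff] at *
  rw [alive_iff] at h
  rw [Fin.lt_def] at hij
  rw [Fin.ext_iff, ind_val, Fin.val_castSucc]
  split_ifs at * <;> omega

/-- If `R_i` and `R_j` overlap at `k + 1` but not at `k`, and `i < j`, then it is `R_i` that starts
at `k + 1`. -/
theorem ind_left_eq {i j : Fin (2 * n)} (hij : i < j) {k l : Fin n} (hkl : (l : ℕ) = (k : ℕ) + 1)
    (hi : Alive i l) (hj : Alive j l) (h : ¬ (Alive i k ∧ Alive j k)) : ind i = l.castSucc := by
  rw [alive_iff] at *
  rw [alive_iff] at h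
  rw [Fin.lt_def] at hij
  rw [Fin.ext_iff, ind_val, Fin.val_castSucc]
  split_ifs at * <;> omega

theorem ind_ne_castSucc {i : Fin (2 * n)} {k l : Fin n} (hkl : (l : ℕ) = (k : ℕ) + 1)
    (hk : Alive i k) (hl : Alive i l) : ind i ≠ l.castSucc := by
  intro h
  rw [alive_iff] at *
  rw [Fin.ext_iff, ind_val, Fin.val_castSucc] at h
  split_ifs at * <;> omega

theorem Alive.of_le_of_le {i : Fin (2 * n)} {k l m : Fin n} (hk : Alive i k) (hm : Alive i m)
    (hkl : k ≤ l) (hlm : l ≤ m) : Alive i l := by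
  rw [alive_iff] at *
  rw [Fin.le_def] at *
  split_ifs at * <;> omega

theorem mem_R_iff (i : Fin (2 * n)) (k : Fin n) (v : W n) :
    v ∈ R i k ↔ ∀ a, summand k a ≠ i → v a = 0 := by
  have h : {v : W n | ∃ a, summand k a = i ∧ v = w a} = w '' {a | summand k a = i} := by
    ext v
    simp [eq_comm]
  rw [R, h, mem_span_w_iff]
  rfl

/-! ### Elementary homomorphisms and one-parameter subgroups -/

open Classical in
/-- The elementary map `R_i → R_j` at the vertex `k`: it takes `w_a ∈ R_i` to `w_b ∈ R_j` and kills
the other basis vectors; it is zero if `R_i` and `R_j` are not both supported at `k`. -/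
def elem (i j : Fin (2 * n)) (k : Fin n) : Module.End ℂ (W n) :=
  if Alive i k ∧ Alive j k then (LinearMap.proj (ind i)).smulRight (w (ind j)) else 0

theorem elem_apply {i j : Fin (2 * n)} {k : Fin n} (h : Alive i k ∧ Alive j k) (v : W n) :
    elem i j k v = v (ind i) • w (ind j) := by
  simp [elem, h]

theorem elem_of_not {i j : Fin (2 * n)} {k : Fin n} (h : ¬ (Alive i k ∧ Alive j k)) :
    elem i j k = 0 := by
  simp [elem, h]

theorem elem_elem {i j : Fin (2 * n)} (hij : i ≠ j) (k : Fin n) (v : W n) :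
    elem i j k (elem i j k v) = 0 := by
  by_cases h : Alive i k ∧ Alive j k
  · rw [elem_apply h, elem_apply h]
    simp [w_apply, ind_ne hij h.1 h.2]
  · simp [elem_of_not h]

theorem elem_comm {i j : Fin (2 * n)} (hij : i < j) (k l : Fin n) (hkl : (l : ℕ) = (k : ℕ) + 1)
    (v : W n) : elem i j l (pr l.castSucc v) = pr l.castSucc (elem i j k v) := by
  by_cases hk : Alive i k ∧ Alive j k <;> by_cases hl : Alive i l ∧ Alive j l
  · rw [elem_apply hk, elem_apply hl, map_smul, pr_w_of_ne (ind_ne_castSucc hkl hk.2 hl.2),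
      pr_apply, if_neg (ind_ne_castSucc hkl hk.1 hl.1)]
  · rw [elem_apply hk, elem_of_not hl, ind_right_eq hij hkl hk.1 hk.2 hl]
    funext b
    simp [pr_apply, w_apply]
    tauto
  · rw [elem_of_not hk, elem_apply hl, ind_left_eq hij hkl hl.1 hl.2 hk]
    simp [pr_apply]
  · simp [elem_of_not hk, elem_of_not hl]

theorem elem_mem_homR {i j : Fin (2 * n)} (hij : i < j) : elem i j ∈ homR i j := by
  refine ⟨elem_comm hij, fun k v _ => ?_, fun k m hm v hv => ?_⟩
  · rw [mem_R_iff]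
    intro a ha
    by_cases h : Alive i k ∧ Alive j k
    · have : a ≠ ind j := fun e => ha (e ▸ h.2)
      simp [elem_apply h, w_apply, this]
    · simp [elem_of_not h]
  · rw [mem_R_iff] at hv
    by_cases h : Alive i k ∧ Alive j k
    · rw [elem_apply h, hv _ (by rw [h.1]; exact hm.symm), zero_smul]
    · simp [elem_of_not h]

theorem apply_of_mem_homR {i j : Fin (2 * n)} {f : Fin n → Module.End ℂ (W n)} (hf : f ∈ homR i j)
    (k : Fin n) : f k = f k (w (ind i)) (ind j) • elem i j k := by
  apply LinearMap.ext
  intro v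
  have hv : f k v = ∑ a, v a • f k (w a) := by
    conv_lhs => rw [← sum_smul_w v, map_sum]
    simp
  have hz : ∀ a, summand k a ≠ i → f k (w a) = 0 := by
    intro a ha
    refine hf.2.2 k (summand k a) ha _ ?_
    rw [mem_R_iff]
    intro b hb
    have : b ≠ a := fun e => hb (e ▸ rfl)
    simp [w_apply, this]
  by_cases hi : Alive i k
  · have hs : f k v = v (ind i) • f k (w (ind i)) := by
      rw [hv, Finset.sum_eq_single (ind i)]
      · intro b _ hb
        rw [hz b fun e => hb (summand_eq_iff.1 e).1, smul_zero]
      · simp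
    have hR : f k (w (ind i)) ∈ R j k := by
      refine hf.2.1 k _ ?_
      rw [mem_R_iff]
      intro b hb
      have : b ≠ ind i := fun e => hb (e ▸ hi)
      simp [w_apply, this]
    rw [mem_R_iff] at hR
    by_cases hj : Alive j k
    · have := eq_smul_w (v := f k (w (ind i))) (a := ind j) fun b hb =>
        hR b fun e => hb (summand_eq_iff.1 e).1
      rw [hs, LinearMap.smul_apply, elem_apply ⟨hi, hj⟩, smul_comm, ← this]
    · rw [elem_of_not fun h => hj h.2]
      have : f k (w (ind i)) = 0 := by
        funext b
        exact hR b fun e => hj (summand_eq_iff.1 e).2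
      simp [hs, this]
  · rw [elem_of_not fun h => hi h.1, hv]
    simp only [smul_zero, LinearMap.zero_apply]
    refine Finset.sum_eq_zero fun a _ => ?_
    rw [hz a fun e => hi (summand_eq_iff.1 e).2, smul_zero]

/-- `Hom (R_i, R_j)` is spanned by the elementary homomorphism: the coefficients at consecutive
vertices agree, since the structure maps of `R_i` and `R_j` are isomorphisms on the supports, and
the supports intersect in an interval. -/
theorem exists_eq_smul_elem {i j : Fin (2 * n)} {f : Fin n → Module.End ℂ (W n)}
    (hf : f ∈ homR i j) : ∃ c : ℂ, f = c • elem i j := by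
  by_cases hex : ∃ k, Alive i k ∧ Alive j k
  · obtain ⟨k₀, hk₀⟩ := hex
    have step : ∀ k l : Fin n, (l : ℕ) = (k : ℕ) + 1 → Alive i k ∧ Alive j k →
        Alive i l ∧ Alive j l → f k (w (ind i)) (ind j) = f l (w (ind i)) (ind j) := by
      intro k l hkl hk hl
      have h := congrFun (hf.1 k l hkl (w (ind i))) (ind j)
      rw [pr_w_of_ne (ind_ne_castSucc hkl hk.1 hl.1), pr_apply,
        if_neg (ind_ne_castSucc hkl hk.2 hl.2)] at h
      exact h.symm
    have chain : ∀ (d : ℕ) (k l : Fin n), (l : ℕ) = (k : ℕ) + d → Alive i k ∧ Alive j k →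
        Alive i l ∧ Alive j l → f k (w (ind i)) (ind j) = f l (w (ind i)) (ind j) := by
      intro d
      induction d with
      | zero =>
        intro k l hkl _ _
        rw [show l = k from Fin.ext (by simpa using hkl)]
      | succ d ih =>
        intro k l hkl hk hl
        have hm : (k : ℕ) + d < n := by omega
        have hkm : k ≤ ⟨(k : ℕ) + d, hm⟩ := by simp [Fin.le_def]
        have hml : (⟨(k : ℕ) + d, hm⟩ : Fin n) ≤ l := by simp [Fin.le_def]; omega
        have h := And.intro (hk.1.of_le_of_le hl.1 hkm hml) (hk.2.of_le_of_le hl.2 hkm hml)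
        exact (ih k ⟨(k : ℕ) + d, hm⟩ rfl hk h).trans (step _ _ (by simp; omega) h hl)
    refine ⟨f k₀ (w (ind i)) (ind j), funext fun k => ?_⟩
    rw [Pi.smul_apply, apply_of_mem_homR hf k]
    by_cases hk : Alive i k ∧ Alive j k
    · congr 1
      rcases le_total k k₀ with h | h
      · exact chain ((k₀ : ℕ) - k) k k₀ (by have := Fin.le_def.1 h; omega) hk hk₀
      · exact (chain ((k : ℕ) - k₀) k₀ k (by have := Fin.le_def.1 h; omega) hk₀ hk).symm
    · simp [elem_of_not hk]
  · refine ⟨0, funext fun k => ?_⟩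
    rw [apply_of_mem_homR hf k, elem_of_not fun h => hex ⟨k, h⟩]
    simp

/-- The automorphism `1 + c · elem i j k` of `W`, the exponential of `c · elem i j k`. -/
def shear {i j : Fin (2 * n)} (hij : i ≠ j) (k : Fin n) (c : ℂ) : W n ≃ₗ[ℂ] W n where
  toLinearMap := LinearMap.id + c • elem i j k
  invFun v := v - c • elem i j k v
  left_inv v := by
    simp [elem_elem hij]
  right_inv v := by
    simp [elem_elem hij]

theorem shear_apply {i j : Fin (2 * n)} (hij : i ≠ j) (k : Fin n) (c : ℂ) (v : W n) :
    shear hij k c v = v + c • elem i j k v := rfl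

theorem shear_symm_apply {i j : Fin (2 * n)} (hij : i ≠ j) (k : Fin n) (c : ℂ) (v : W n) :
    (shear hij k c).symm v = v - c • elem i j k v := rfl

/-- The element `exp (c γ)` of `U_{i,j}`, where `γ` is the elementary homomorphism `R_i → R_j`. -/
def oneParam {i j : Fin (2 * n)} (hij : i < j) (c : ℂ) : autM n :=
  ⟨fun k => shear hij.ne k c, fun k l hkl v => by
    rw [shear_apply, shear_apply, elem_comm hij k l hkl, map_add, map_smul]⟩

theorem exp_smul_elem {i j : Fin (2 * n)} (hij : i ≠ j) (k : Fin n) (c : ℂ) :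
    IsNilpotent.exp (c • elem i j k) = (shear hij k c : W n →ₗ[ℂ] W n) := by
  have h : (c • elem i j k) ^ 2 = 0 := by
    apply LinearMap.ext
    intro v
    simp [pow_two, elem_elem hij]
  rw [IsNilpotent.exp_eq_sum h]
  apply LinearMap.ext
  intro v
  simp [Finset.sum_range_succ, shear_apply]

theorem U_eq_range {i j : Fin (2 * n)} (hij : i < j) : U i j = Set.range (oneParam hij) := by
  ext g
  constructor
  · rintro ⟨γ, hγ, hg⟩
    obtain ⟨c, rfl⟩ := exists_eq_smul_elem hγ
    refine ⟨c, Subtype.ext (funext fun k => LinearEquiv.toLinearMap_injective ?_)⟩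
    rw [hg k, Pi.smul_apply, exp_smul_elem hij.ne]
    rfl
  · rintro ⟨c, rfl⟩
    exact ⟨c • elem i j, Submodule.smul_mem _ c (elem_mem_homR hij), fun k =>
      (exp_smul_elem hij.ne k c).symm⟩

/-! ### Effective pairs and their curves -/

/-- The vertex `k` is moved by `U_{i,j}` at `p_S`: both `R_i` and `R_j` live at `k`, and there `p_S`
contains the basis vector of `R_i` but not that of `R_j`. -/
def Admissible.Moved (S : Admissible n) (i j : Fin (2 * n)) (k : Fin n) : Prop :=
  (Alive i k ∧ Alive j k) ∧ ind i ∈ S.S k ∧ ind j ∉ S.S k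

theorem homR_eq_span {i j : Fin (2 * n)} (hij : i < j) :
    homR i j = Submodule.span ℂ {elem i j} := by
  apply le_antisymm
  · intro f hf
    obtain ⟨c, rfl⟩ := exists_eq_smul_elem hf
    exact Submodule.smul_mem _ c (Submodule.mem_span_singleton_self _)
  · rw [Submodule.span_singleton_le_iff_mem]
    exact elem_mem_homR hij

theorem isEffective_iff (S : Admissible n) (i j : Fin (2 * n)) :
    IsEffective S i j ↔ i < j ∧ ∃ k, S.Moved i j k := by
  constructor
  · rintro ⟨hij, hone, -, hγ⟩
    refine ⟨hij, ?_⟩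
    have hne : elem i j ≠ 0 := by
      intro h0
      rw [homR_eq_span hij, h0, Submodule.span_zero_singleton, finrank_bot] at hone
      exact zero_ne_one hone
    have h := hγ _ (elem_mem_homR hij) hne
    push Not at h
    obtain ⟨k, hk⟩ := h
    refine ⟨k, ?_⟩
    rw [Submodule.map_le_iff_le_comap, SetLike.not_le_iff_exists] at hk
    obtain ⟨v, ⟨hv, hvR⟩, hvn⟩ := hk
    rw [Submodule.mem_comap] at hvn
    by_cases ha : Alive i k ∧ Alive j k
    · rw [elem_apply ha] at hvn
      refine ⟨ha, ?_, fun hj => hvn (Submodule.smul_mem _ _ ((S.w_mem_p_iff _ _).2 hj))⟩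
      by_contra hi
      rw [(S.mem_p_iff k v).1 hv _ hi, zero_smul] at hvn
      exact hvn (Submodule.zero_mem _)
    · rw [elem_of_not ha] at hvn
      exact absurd (Submodule.zero_mem _) hvn
  · rintro ⟨hij, k, ha, hi, hj⟩
    have hwR : (w (ind i) : W n) ∈ R i k := by
      rw [mem_R_iff]
      intro b hb
      have : b ≠ ind i := fun e => hb (e ▸ ha.1)
      simp [w_apply, this]
    have hw0 : (w (ind i) : W n) ≠ 0 := linearIndependent_w.ne_zero _
    have hmem : (w (ind i) : W n) ∈ S.p.V k ⊓ R i k := ⟨(S.w_mem_p_iff _ _).2 hi, hwR⟩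
    have hne : elem i j ≠ 0 := by
      intro h0
      have h1 := LinearMap.congr_fun (congrFun h0 k) (w (ind i))
      rw [elem_apply ha] at h1
      have h2 := congrFun h1 (ind j)
      simp [w_apply] at h2
    refine ⟨hij, ?_, ⟨k, fun h => hw0 ?_⟩, fun γ hγ hγ0 h => ?_⟩
    · rw [homR_eq_span hij]
      exact finrank_span_singleton hne
    · rw [h] at hmem
      exact hmem
    · obtain ⟨c, rfl⟩ := exists_eq_smul_elem hγ
      have hc : c ≠ 0 := fun hc => hγ0 (by rw [hc, zero_smul])
      have h1 := h k ⟨_, hmem, rfl⟩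
      rw [Pi.smul_apply, LinearMap.smul_apply, elem_apply ha, S.mem_p_iff] at h1
      have h2 := h1 _ hj
      simp [w_apply, hc] at h2

theorem mem_oneParam_smul_iff (S : Admissible n) {i j : Fin (2 * n)} (hij : i < j) (c : ℂ)
    (k : Fin n) (v : W n) :
    v ∈ (oneParam hij c • S.p).V k ↔ ∀ b, b ∉ S.S k → (v - c • elem i j k v) b = 0 := by
  rw [mem_smul_V_iff, S.mem_p_iff]
  rfl

theorem oneParam_zero_smul (S : Admissible n) {i j : Fin (2 * n)} (hij : i < j) :
    oneParam hij 0 • S.p = S.p := by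
  refine DegFlag.eq_of_le fun k v hv => ?_
  rw [mem_oneParam_smul_iff] at hv
  rw [S.mem_p_iff]
  simpa using hv

theorem oneParam_smul_injective {S : Admissible n} {i j : Fin (2 * n)} (hij : i < j) {k : Fin n}
    (hk : S.Moved i j k) : Function.Injective fun c => oneParam hij c • S.p := by
  intro c d hcd
  have hw : (shear hij.ne k c) (w (ind i)) ∈ (oneParam hij c • S.p).V k :=
    ⟨_, (S.w_mem_p_iff _ _).2 hk.2.1, rfl⟩
  dsimp only at hcd
  rw [hcd, mem_oneParam_smul_iff] at hw
  have h := hw _ hk.2.2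
  have hne := ind_ne hij.ne hk.1.1 hk.1.2
  rw [shear_apply, elem_apply hk.1, elem_apply hk.1] at h
  simpa [w_apply, hne, hne.symm, sub_eq_zero] using h

theorem curve_eq {S : Admissible n} {i j : Fin (2 * n)} (hij : i < j) {k : Fin n}
    (hk : S.Moved i j k) : curve S i j = {x | ∃ c : ℂ, c ≠ 0 ∧ x = oneParam hij c • S.p} := by
  ext x
  rw [curve, U_eq_range hij]
  constructor
  · rintro ⟨⟨_, ⟨c, rfl⟩, rfl⟩, hx⟩
    refine ⟨c, fun hc => hx ?_, rfl⟩
    rw [hc]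
    exact oneParam_zero_smul S hij
  · rintro ⟨c, hc, rfl⟩
    refine ⟨⟨_, ⟨c, rfl⟩, rfl⟩, fun h => hc (oneParam_smul_injective hij hk ?_)⟩
    exact Eq.trans h (oneParam_zero_smul S hij).symm

theorem Admissible.torus_smul_p (S : Admissible n) : IsTFixed S.p := by
  intro t
  refine DegFlag.eq_of_le fun k => ?_
  rintro _ ⟨v, hv, rfl⟩
  rw [SetLike.mem_coe, S.mem_p_iff] at hv
  rw [S.mem_p_iff]
  intro b hb
  change (t (summand k b) : ℂ) * v b = 0
  rw [hv b hb, mul_zero]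

theorem torus_mul_oneParam {i j : Fin (2 * n)} (hij : i < j) (t : Fin (2 * n) → ℂˣ) (c : ℂ) :
    torus n t * oneParam hij c = oneParam hij (c * (t j / t i : ℂˣ)) * torus n t := by
  refine Subtype.ext (funext fun k => LinearEquiv.ext fun v => funext fun b => ?_)
  change (t (summand k b) : ℂ) * (v + c • elem i j k v) b =
    (t (summand k b) : ℂ) * v b +
      ((c * (t j / t i : ℂˣ)) • elem i j k (fun a => (t (summand k a) : ℂ) * v a)) b
  by_cases h : Alive i k ∧ Alive j k
  · rw [elem_apply h, elem_apply h]
    by_cases hb : b = ind j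
    · subst hb
      have h1 : summand k (ind i) = i := h.1
      have h2 : summand k (ind j) = j := h.2
      simp [w_apply, h1, h2]
      field_simp
    · simp [w_apply, hb]
  · simp [elem_of_not h]

theorem torus_smul_oneParam_smul (S : Admissible n) {i j : Fin (2 * n)} (hij : i < j)
    (t : Fin (2 * n) → ℂˣ) (c : ℂ) :
    torus n t • oneParam hij c • S.p = oneParam hij (c * (t j / t i : ℂˣ)) • S.p := by
  rw [← mul_smul, torus_mul_oneParam, mul_smul, S.torus_smul_p]

theorem mem_lieStab_oneParam_smul_iff {S : Admissible n} {i j : Fin (2 * n)} (hij : i < j)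
    {k : Fin n} (hk : S.Moved i j k) {c : ℂ} (hc : c ≠ 0) (X : Fin (2 * n) → ℂ) :
    X ∈ lieStab (oneParam hij c • S.p) ↔ X i = X j := by
  have hdiv : ∀ s : ℂ, ((expT (s • X) j / expT (s • X) i : ℂˣ) : ℂ) =
      Complex.exp (s * (X j - X i)) := by
    intro s
    rw [Units.val_div_eq_div_val]
    simp [expT, ← Complex.exp_sub, mul_sub]
  change (∀ s : ℂ, _) ↔ _
  simp only [torus_smul_oneParam_smul, hdiv]
  constructor
  · intro h
    by_contra hne
    have hne' : X j - X i ≠ 0 := sub_ne_zero.2 (Ne.symm hne)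
    have h1 := oneParam_smul_injective hij hk (h (1 / (X j - X i)))
    rw [one_div_mul_cancel hne', mul_eq_left₀ hc] at h1
    have h2 := congrArg norm h1
    rw [Complex.norm_exp] at h2
    simp at h2
  · intro h s
    simp [h]

theorem curve_eq_orbit {S : Admissible n} {i j : Fin (2 * n)} (hij : i < j) {k : Fin n}
    (hk : S.Moved i j k) {c : ℂ} (hc : c ≠ 0) : curve S i j = orbit (oneParam hij c • S.p) := by
  rw [curve_eq hij hk]
  ext x
  constructor
  · rintro ⟨d, hd, rfl⟩
    refine ⟨fun m => if m = j then Units.mk0 (d / c) (div_ne_zero hd hc) else 1, ?_⟩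
    dsimp only
    rw [torus_smul_oneParam_smul, if_pos rfl, if_neg hij.ne, div_one, Units.val_mk0,
      mul_div_cancel₀ _ hc]
  · rintro ⟨t, rfl⟩
    exact ⟨_, mul_ne_zero hc (Units.ne_zero _), torus_smul_oneParam_smul S hij t c⟩

/-- The linear form `X ↦ X_i - X_j` on the Lie algebra of `T`. -/
def rootForm (i j : Fin (2 * n)) : Module.Dual ℂ (Fin (2 * n) → ℂ) :=
  (LinearMap.proj i : (Fin (2 * n) → ℂ) →ₗ[ℂ] ℂ) - LinearMap.proj j

theorem rootForm_apply (i j : Fin (2 * n)) (X : Fin (2 * n) → ℂ) : rootForm i j X = X i - X j := rfl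

theorem rootForm_ne_zero {i j : Fin (2 * n)} (hij : i ≠ j) : rootForm i j ≠ 0 := by
  intro h
  have := LinearMap.congr_fun h (Pi.single i 1)
  simp [rootForm_apply, hij.symm] at this

theorem lieStab_oneParam_smul {S : Admissible n} {i j : Fin (2 * n)} (hij : i < j)
    {k : Fin n} (hk : S.Moved i j k) {c : ℂ} (hc : c ≠ 0) :
    lieStab (oneParam hij c • S.p) = LinearMap.ker (rootForm i j) := by
  ext X
  rw [mem_lieStab_oneParam_smul_iff hij hk hc, LinearMap.mem_ker, rootForm_apply, sub_eq_zero]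

theorem isOneDimOrbit_curve {S : Admissible n} {i j : Fin (2 * n)} (hij : i < j) {k : Fin n}
    (hk : S.Moved i j k) : IsOneDimOrbit (curve S i j) := by
  refine ⟨_, curve_eq_orbit hij hk one_ne_zero, ?_⟩
  rw [lieStab_oneParam_smul hij hk one_ne_zero,
    Module.Dual.finrank_ker_add_one_of_ne_zero (rootForm_ne_zero hij.ne)]

theorem isEdgeLabel_curve {S : Admissible n} {i j : Fin (2 * n)} (hij : i < j) {k : Fin n}
    (hk : S.Moved i j k) : IsEdgeLabel (curve S i j) (alpha i j) := by
  have hne : alpha i j ≠ 0 := by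
    intro h
    have hX : (Pi.single i 1 - Pi.single j 1 : Fin (2 * n) → ℂ) ∈ traceless n := by
      change ∑ m, _ = _
      simp [Finset.sum_sub_distrib]
    have h1 : (Pi.single i 1 - Pi.single j 1 : Fin (2 * n) → ℂ) i -
      (Pi.single i 1 - Pi.single j 1 : Fin (2 * n) → ℂ) j = 0 := LinearMap.congr_fun h ⟨_, hX⟩
    simp [hij.ne, hij.ne'] at h1
  refine ⟨hne, fun x hx => ?_⟩
  rw [curve_eq hij hk] at hx
  obtain ⟨c, hc, rfl⟩ := hx
  have hker : tStab (oneParam hij c • S.p) = LinearMap.ker (alpha i j) := by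
    rw [tStab, lieStab_oneParam_smul hij hk hc]
    rfl
  rw [hker]
  refine ⟨LinearMap.isCoatom_ker_of_surjective (LinearMap.surjective hne), ?_⟩
  rw [Submodule.mem_dualAnnihilator]
  exact fun X hX => hX

/-! ### Points with a one-dimensional orbit -/

/-- The character `s ↦ exp (s z)` of the additive group of `ℂ`. -/
def expChar (z : ℂ) : Multiplicative ℂ →* ℂ where
  toFun s := Complex.exp (s.toAdd * z)
  map_one' := by simp
  map_mul' s t := by simp [add_mul, Complex.exp_add]

theorem expChar_injective : Function.Injective expChar := by
  intro z z' h
  by_contra hne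
  have hne' : z - z' ≠ 0 := sub_ne_zero.2 hne
  have h1 : Complex.exp (1 / (z - z') * z) = Complex.exp (1 / (z - z') * z') :=
    DFunLike.congr_fun h (Multiplicative.ofAdd (1 / (z - z')))
  rw [← div_eq_one_iff_eq (Complex.exp_ne_zero _), ← Complex.exp_sub, ← mul_sub,
    one_div_mul_cancel hne'] at h1
  have h2 := congrArg norm h1
  rw [Complex.norm_exp] at h2
  simp at h2

/-- If `exp (s X)` fixes the point `x` for all `s`, then each space of `x` is the sum of its
intersections with the eigenspaces of `X`: a linear form that vanishes on the space of `x` gives a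
linear relation between the characters `s ↦ exp (s z)`, which are linearly independent. -/
theorem restrict_mem_of_mem_lieStab {x : DegFlag n} {X : Fin (2 * n) → ℂ} (hX : X ∈ lieStab x)
    {k : Fin n} {v : W n} (hv : v ∈ x.V k) (z : ℂ) :
    (fun a => if X (summand k a) = z then v a else 0 : W n) ∈ x.V k := by
  classical
  by_contra h
  obtain ⟨f, hf, hle⟩ := Submodule.exists_le_ker_of_notMem h
  let r : ℂ → W n := fun z a => if X (summand k a) = z then v a else 0
  let Z : Finset ℂ := insert z (Finset.univ.image fun a => X (summand k a))
  have hrel : ∀ s : ℂ, ∑ y ∈ Z, f (r y) * Complex.exp (s * y) = 0 := by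
    intro s
    have h1 := torus_mem hv (expT (s • X))
    rw [hX s] at h1
    have h2 : (fun a => ((expT (s • X) (summand k a) : ℂˣ) : ℂ) * v a : W n) =
        ∑ y ∈ Z, Complex.exp (s * y) • r y := by
      funext a
      have ha : X (summand k a) ∈ Z :=
        Finset.mem_insert_of_mem (Finset.mem_image_of_mem _ (Finset.mem_univ a))
      simp [r, expT, ha]
    rw [h2] at h1
    have h3 := hle h1
    rw [LinearMap.mem_ker, map_sum] at h3
    simpa [mul_comm] using h3
  have hli := ((linearIndependent_monoidHom (Multiplicative ℂ) ℂ).comp expChar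
    expChar_injective)
  rw [linearIndependent_iff'] at hli
  refine hf (hli Z (fun y => f (r y)) ?_ z (Finset.mem_insert_self _ _))
  funext s
  simpa [expChar] using hrel s.toAdd

theorem isTFixed_of_smul_w_mem {x : DegFlag n}
    (h : ∀ k, ∀ v ∈ x.V k, ∀ a, v a • (w a : W n) ∈ x.V k) : IsTFixed x := by
  intro t
  refine DegFlag.eq_of_le fun k => ?_
  rintro _ ⟨v, hv, rfl⟩
  refine mem_of_forall_smul_w_mem fun a => ?_
  change ((t (summand k a) : ℂ) * v a) • (w a : W n) ∈ x.V k
  rw [mul_smul]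
  exact Submodule.smul_mem _ _ (h k v hv a)

theorem smul_w_mem_of_mem_lieStab {x : DegFlag n} {X : Fin (2 * n) → ℂ} (hX : X ∈ lieStab x)
    {k : Fin n} {v : W n} (hv : v ∈ x.V k) {a : Fin (n + 1)}
    (ha : ∀ m, m ≠ summand k a → X m ≠ X (summand k a)) : v a • (w a : W n) ∈ x.V k := by
  convert restrict_mem_of_mem_lieStab hX hv (X (summand k a)) using 1
  funext b
  by_cases hb : b = a
  · simp [hb, w_apply]
  · simp [hb, w_apply, ha _ fun e => hb (summand_injective k e)]

/-- The Lie algebra of the stabilizer of a point with a one-dimensional orbit is the kernel of a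
root: a hyperplane that lies in no root hyperplane contains an element with distinct coordinates,
and a point that is stabilized by such an element is fixed by `T`. -/
theorem exists_lieStab_eq_ker {x : DegFlag n}
    (hx : Module.finrank ℂ (Fin (2 * n) → ℂ) = Module.finrank ℂ (lieStab x) + 1) :
    ∃ i j : Fin (2 * n), i < j ∧ lieStab x = LinearMap.ker (rootForm i j) := by
  by_contra hcon
  have key : ∀ p : {p : Fin (2 * n) × Fin (2 * n) // p.1 < p.2},
      ∃ X ∈ lieStab x, rootForm p.1.1 p.1.2 X ≠ 0 := by
    intro p
    by_contra! h
    refine hcon ⟨p.1.1, p.1.2, p.2, Submodule.eq_of_le_of_finrank_eq (fun X hX => h X hX) ?_⟩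
    have := Module.Dual.finrank_ker_add_one_of_ne_zero (rootForm_ne_zero p.2.ne)
    omega
  obtain ⟨X, hX, hne⟩ := Module.Dual.exists_forall_mem_ne_zero_of_forall_exists _ _ key
  have hinj : ∀ m m', m ≠ m' → X m ≠ X m' := by
    intro m m' hmm h
    rcases lt_or_gt_of_ne hmm with hlt | hlt
    · exact hne ⟨(m, m'), hlt⟩ (sub_eq_zero.2 h)
    · exact hne ⟨(m', m), hlt⟩ (sub_eq_zero.2 h.symm)
  have hfix : IsTFixed x := isTFixed_of_smul_w_mem fun k v hv a =>
    smul_w_mem_of_mem_lieStab hX hv fun m hm => hinj _ _ hm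
  have htop : lieStab x = ⊤ := eq_top_iff.2 fun Y _ s => hfix _
  rw [htop, finrank_top] at hx
  omega

/-- Along the common support of `R_i` and `R_j` the structure maps fix the vectors of
`R_i ⊕ R_j`. -/
theorem DegFlag.add_mem_of_le (x : DegFlag n) {i j : Fin (2 * n)} (s t : ℂ) {k l : Fin n}
    (hk : Alive i k ∧ Alive j k) (hl : Alive i l ∧ Alive j l) (hkl : k ≤ l)
    (h : s • w (ind i) + t • w (ind j) ∈ x.V k) : s • w (ind i) + t • w (ind j) ∈ x.V l := by
  have chain : ∀ (d : ℕ) (l : Fin n), (l : ℕ) = (k : ℕ) + d → Alive i l ∧ Alive j l →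
      s • w (ind i) + t • w (ind j) ∈ x.V l := by
    intro d
    induction d with
    | zero =>
      intro l hl _
      rwa [show l = k from Fin.ext (by simpa using hl)]
    | succ d ih =>
      intro l hl hal
      have hm : (k : ℕ) + d < n := by omega
      have hkm : k ≤ ⟨(k : ℕ) + d, hm⟩ := by simp [Fin.le_def]
      have hml : (⟨(k : ℕ) + d, hm⟩ : Fin n) ≤ l := by simp [Fin.le_def]; omega
      have ham := And.intro (hk.1.of_le_of_le hal.1 hkm hml) (hk.2.of_le_of_le hal.2 hkm hml)
      have hs : (l : ℕ) = ((⟨(k : ℕ) + d, hm⟩ : Fin n) : ℕ) + 1 := by simp; omega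
      have h1 := x.pr_mem hs (ih ⟨(k : ℕ) + d, hm⟩ rfl ham)
      rwa [map_add, map_smul, map_smul, pr_w_of_ne (ind_ne_castSucc hs ham.1 hal.1),
        pr_w_of_ne (ind_ne_castSucc hs ham.2 hal.2)] at h1
  exact chain ((l : ℕ) - k) l (by have := Fin.le_def.1 hkl; omega) hl

/-- The point `x` is homogeneous for the grading in which only the degrees of `R_i` and `R_j`
coincide: the coordinates of its vectors in the other summands can be split off. -/
def IsHomogeneousAwayFrom (i j : Fin (2 * n)) (x : DegFlag n) : Prop :=
  ∀ k, ∀ v ∈ x.V k, ∀ a, summand k a ≠ i → summand k a ≠ j → v a • (w a : W n) ∈ x.V k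

theorem isHomogeneousAwayFrom_of_lieStab {x : DegFlag n} {i j : Fin (2 * n)}
    (h : lieStab x = LinearMap.ker (rootForm i j)) : IsHomogeneousAwayFrom i j x := by
  intro k v hv a hi hj
  -- an element of the root hyperplane whose only coincidence of coordinates is at `i` and `j`
  let X : Fin (2 * n) → ℂ := fun m => if m = j then ((i : ℕ) : ℂ) else ((m : ℕ) : ℂ)
  have hX : X ∈ lieStab x := by
    rw [h, LinearMap.mem_ker, rootForm_apply]
    simp [X]
  refine smul_w_mem_of_mem_lieStab hX hv fun m hm => ?_
  simp only [X, if_neg hj]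
  split_ifs with hmj
  · simpa [Fin.val_inj] using hi.symm
  · simpa [Fin.val_inj] using hm

namespace IsHomogeneousAwayFrom

variable {i j : Fin (2 * n)} {x : DegFlag n}

theorem restrict_mem (hx : IsHomogeneousAwayFrom i j x) {k : Fin n} {v : W n} (hv : v ∈ x.V k) :
    (fun a => if summand k a = i ∨ summand k a = j then v a else 0 : W n) ∈ x.V k := by
  have h : (fun a => if summand k a = i ∨ summand k a = j then v a else 0 : W n) =
      v - (fun a => if summand k a = i ∨ summand k a = j then 0 else v a) := by
    funext a
    simp only [Pi.sub_apply]
    split_ifs <;> simp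
  rw [h]
  refine Submodule.sub_mem _ hv (mem_of_forall_smul_w_mem fun a => ?_)
  split_ifs with ha
  · rw [zero_smul]
    exact Submodule.zero_mem _
  · rw [not_or] at ha
    exact hx k v hv a ha.1 ha.2

theorem pair_mem (hx : IsHomogeneousAwayFrom i j x) (hij : i ≠ j) {k : Fin n}
    (hk : Alive i k ∧ Alive j k) {v : W n} (hv : v ∈ x.V k) :
    v (ind i) • w (ind i) + v (ind j) • w (ind j) ∈ x.V k := by
  convert hx.restrict_mem hv using 1
  have hne := ind_ne hij hk.1 hk.2
  funext a
  simp only [summand_eq_iff, hk.1, hk.2, and_true, Pi.add_apply, Pi.smul_apply, w_apply,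
    smul_eq_mul, mul_ite, mul_one, mul_zero]
  by_cases h1 : a = ind i
  · simp [h1, hne]
  · by_cases h2 : a = ind j
    · simp [h2, hne.symm]
    · simp [h1, h2]

theorem smul_w_mem (hx : IsHomogeneousAwayFrom i j x) {k : Fin n}
    (hk : ¬ (Alive i k ∧ Alive j k)) {v : W n} (hv : v ∈ x.V k) (a : Fin (n + 1)) :
    v a • (w a : W n) ∈ x.V k := by
  by_cases ha : summand k a = i ∨ summand k a = j
  · convert hx.restrict_mem hv using 1
    funext b
    by_cases hb : b = a
    · subst hb
      simp [w_apply, ha]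
    · have : ¬ (summand k b = i ∨ summand k b = j) := by
        simp only [summand_eq_iff] at *
        rintro (⟨rfl, h1⟩ | ⟨rfl, h1⟩) <;> rcases ha with ⟨rfl, h2⟩ | ⟨rfl, h2⟩ <;> tauto
      simp [w_apply, hb, this]
  · rw [not_or] at ha
    exact hx k v hv a ha.1 ha.2

/-- If a homogeneous point is not fixed by the torus, then at some vertex it contains a vector
`w_a + c w_b` with `w_a ∈ R_i`, `w_b ∈ R_j` and `c ≠ 0`, but not `w_b`. -/
theorem exists_mixed (hx : IsHomogeneousAwayFrom i j x) (hij : i ≠ j) (hfix : ¬ IsTFixed x) :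
    ∃ k, (Alive i k ∧ Alive j k) ∧ ∃ c : ℂ, c ≠ 0 ∧
      w (ind i) + c • w (ind j) ∈ x.V k ∧ (w (ind j) : W n) ∉ x.V k := by
  have h := mt isTFixed_of_smul_w_mem hfix
  push Not at h
  obtain ⟨k, v, hv, e, he⟩ := h
  have hk : Alive i k ∧ Alive j k := by
    by_contra hk
    exact he (hx.smul_w_mem hk hv e)
  have hp := hx.pair_mem hij hk hv
  have hcases : e = ind i ∨ e = ind j := by
    by_contra hcon
    rw [not_or] at hcon
    exact he (hx k v hv e (fun h => hcon.1 (summand_eq_iff.1 h).1)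
      (fun h => hcon.2 (summand_eq_iff.1 h).1))
  have hi0 : v (ind i) ≠ 0 := by
    intro h0
    rcases hcases with rfl | rfl
    · rw [h0, zero_smul] at he
      exact he (Submodule.zero_mem _)
    · rw [h0, zero_smul, zero_add] at hp
      exact he hp
  have hnj : v (ind j) • (w (ind j) : W n) ∉ x.V k := by
    intro hj
    rcases hcases with rfl | rfl
    · exact he ((Submodule.add_mem_iff_left _ hj).1 hp)
    · exact he hj
  refine ⟨k, hk, v (ind j) / v (ind i), div_ne_zero (fun h0 => hnj ?_) hi0, ?_, fun hj =>
    hnj (Submodule.smul_mem _ _ hj)⟩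
  · rw [h0, zero_smul]
    exact Submodule.zero_mem _
  · have := Submodule.smul_mem _ (v (ind i))⁻¹ hp
    rwa [smul_add, smul_smul, smul_smul, inv_mul_cancel₀ hi0, one_smul, mul_comm,
      ← div_eq_mul_inv] at this

/-- A mixed vector `w_a + c w_b` at one vertex, where `w_b` is missing, determines the slope at all
others: forwards it is carried along by the structure maps, and backwards a vector of another slope
would be carried along to produce `w_b`. -/
theorem mixed_vector_mem (hx : IsHomogeneousAwayFrom i j x) (hij : i ≠ j) {k₀ : Fin n}
    (hk₀ : Alive i k₀ ∧ Alive j k₀) {c : ℂ} (hz : w (ind i) + c • w (ind j) ∈ x.V k₀)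
    (hj : (w (ind j) : W n) ∉ x.V k₀) {k : Fin n} (hk : Alive i k ∧ Alive j k) {v : W n}
    (hv : v ∈ x.V k) (hvi : v (ind i) ≠ 0 ∨ v (ind j) ≠ 0) :
    w (ind i) + c • w (ind j) ∈ x.V k := by
  rcases le_total k₀ k with h | h
  · have := x.add_mem_of_le 1 c hk₀ hk h (by rwa [one_smul])
    rwa [one_smul] at this
  · have hp := hx.pair_mem hij hk hv
    have h1 := x.add_mem_of_le _ _ hk hk₀ h hp
    have h2 : (v (ind j) - v (ind i) * c) • (w (ind j) : W n) ∈ x.V k₀ := by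
      have := Submodule.sub_mem _ h1 (Submodule.smul_mem _ (v (ind i)) hz)
      convert this using 1
      module
    have h3 : v (ind j) = v (ind i) * c := by
      by_contra hne
      exact hj ((Submodule.smul_mem_iff _ (sub_ne_zero.2 hne)).1 h2)
    have h4 : v (ind i) ≠ 0 := by
      rcases hvi with h | h
      · exact h
      · intro h0
        rw [h0, zero_mul] at h3
        exact h h3
    rw [h3, mul_smul, ← smul_add] at hp
    exact (Submodule.smul_mem_iff _ h4).1 hp

open Classical in
/-- The collection of the indices of the basis vectors that are leading terms of vectors of `x`,
where `R_i` leads before `R_j`. -/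
def leading (i : Fin (2 * n)) (x : DegFlag n) (k : Fin n) : Finset (Fin (n + 1)) :=
  {e | (w e : W n) ∈ x.V k ∨ (summand k e = i ∧ ∃ v ∈ x.V k, v e ≠ 0)}

theorem mem_leading {k : Fin n} {e : Fin (n + 1)} : e ∈ leading i x k ↔
    (w e : W n) ∈ x.V k ∨ (summand k e = i ∧ ∃ v ∈ x.V k, v e ≠ 0) := by
  simp [leading]

theorem leading_subset {k l : Fin n} (hkl : (l : ℕ) = (k : ℕ) + 1) :
    leading i x k ⊆ leading i x l ∪ {l.castSucc} := by
  intro e he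
  rw [Finset.mem_union, Finset.mem_singleton]
  by_cases hel : e = l.castSucc
  · exact Or.inr hel
  refine Or.inl ?_
  rw [mem_leading] at he ⊢
  rcases he with he | ⟨he, v, hv, hve⟩
  · left
    have := x.pr_mem hkl he
    rwa [pr_w_of_ne hel] at this
  · right
    refine ⟨by rw [← summand_eq_of_ne hkl hel, he], _, x.pr_mem hkl hv, ?_⟩
    rwa [pr_apply, if_neg hel]

/-- Each space of `x` is a sheared coordinate subspace. -/
theorem map_shear_span_leading (hx : IsHomogeneousAwayFrom i j x) (hij : i ≠ j) {k₀ : Fin n}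
    (hk₀ : Alive i k₀ ∧ Alive j k₀) {c : ℂ} (hz : w (ind i) + c • w (ind j) ∈ x.V k₀)
    (hj : (w (ind j) : W n) ∉ x.V k₀) (k : Fin n) :
    (Submodule.span ℂ (w '' (leading i x k : Set (Fin (n + 1))))).map
      (shear hij k c : W n →ₗ[ℂ] W n) = x.V k := by
  apply le_antisymm
  · rw [Submodule.map_span, Submodule.span_le]
    rintro _ ⟨_, ⟨e, he, rfl⟩, rfl⟩
    rw [Finset.mem_coe, mem_leading] at he
    change shear hij k c (w e) ∈ x.V k
    rw [shear_apply]
    by_cases hk : Alive i k ∧ Alive j k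
    · rw [elem_apply hk]
      by_cases hei : e = ind i
      · subst hei
        rw [w_apply, if_pos rfl, one_smul]
        rcases he with he | ⟨-, v, hv, hve⟩
        · exact hx.mixed_vector_mem hij hk₀ hz hj hk he (Or.inl (by simp [w_apply]))
        · exact hx.mixed_vector_mem hij hk₀ hz hj hk hv (Or.inl hve)
      · rw [w_apply, if_neg (Ne.symm hei), zero_smul, smul_zero, add_zero]
        rcases he with he | ⟨h, -⟩
        · exact he
        · exact absurd (summand_eq_iff.1 h).1 hei
    · rw [elem_of_not hk, LinearMap.zero_apply, smul_zero, add_zero]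
      rcases he with he | ⟨-, v, hv, hve⟩
      · exact he
      · exact (Submodule.smul_mem_iff _ hve).1 (hx.smul_w_mem hk hv e)
  · intro v hv
    refine ⟨(shear hij k c).symm v, ?_, by simp⟩
    rw [SetLike.mem_coe, mem_span_w_iff]
    intro b hb
    rw [Finset.mem_coe, mem_leading, not_or] at hb
    rw [shear_symm_apply]
    by_cases hk : Alive i k ∧ Alive j k
    · rw [elem_apply hk]
      by_cases hbi : b = ind i
      · subst hbi
        have h0 : v (ind i) = 0 := by
          by_contra hne
          exact hb.2 ⟨hk.1, v, hv, hne⟩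
        simp [h0]
      · by_cases hbj : b = ind j
        · subst hbj
          by_cases h0 : v (ind i) = 0 ∧ v (ind j) = 0
          · simp [h0.1, h0.2]
          · have hzk := hx.mixed_vector_mem hij hk₀ hz hj hk hv (by tauto)
            have hp := Submodule.sub_mem _ (hx.pair_mem hij hk hv)
              (Submodule.smul_mem _ (v (ind i)) hzk)
            have h2 : (v (ind j) - c * v (ind i)) • (w (ind j) : W n) ∈ x.V k := by
              convert hp using 1
              module
            have h3 : v (ind j) - c * v (ind i) = 0 := by
              by_contra hne
              exact hb.1 ((Submodule.smul_mem_iff _ hne).1 h2)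
            simpa [w_apply] using h3
        · have h0 : v b = 0 := by
            by_contra hne
            exact hb.1 ((Submodule.smul_mem_iff _ hne).1 (hx k v hv b
              (fun h => hbi (summand_eq_iff.1 h).1) (fun h => hbj (summand_eq_iff.1 h).1)))
          simp [h0, w_apply, hbj]
    · have h0 : v b = 0 := by
        by_contra hne
        exact hb.1 ((Submodule.smul_mem_iff _ hne).1 (hx.smul_w_mem hk hv b))
      simp [elem_of_not hk, h0]

/-- A homogeneous point that is not fixed by the torus lies on the curve of an effective pair. -/
theorem exists_eq_oneParam_smul (hx : IsHomogeneousAwayFrom i j x) (hij : i < j)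
    (hfix : ¬ IsTFixed x) : ∃ (S : Admissible n) (k : Fin n) (c : ℂ), S.Moved i j k ∧ c ≠ 0 ∧
      x = oneParam hij c • S.p := by
  obtain ⟨k₀, hk₀, c, hc, hz, hj⟩ := hx.exists_mixed hij.ne hfix
  have hmap := hx.map_shear_span_leading hij.ne hk₀ hz hj
  let S : Admissible n :=
    { S := leading i x
      card_eq := fun k => by
        rw [← finrank_span_w, ← x.finrank_eq k, ← hmap k]
        exact (LinearEquiv.finrank_map_eq _ _).symm
      subset := fun k l hkl => leading_subset hkl }
  refine ⟨S, k₀, c, ⟨hk₀, ?_, fun h => ?_⟩, hc, ?_⟩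
  · refine mem_leading.2 (Or.inr ⟨hk₀.1, _, hz, ?_⟩)
    simp [w_apply, ind_ne hij.ne hk₀.1 hk₀.2]
  · rcases mem_leading.1 h with h | ⟨h, -⟩
    · exact hj h
    · exact hij.ne (h.symm.trans hk₀.2)
  · refine (DegFlag.ext (funext hmap)).symm

end IsHomogeneousAwayFrom

theorem isOneDimOrbit_iff (L : Set (DegFlag n)) : IsOneDimOrbit L ↔
    ∃ (S : Admissible n) (i j : Fin (2 * n)), IsEffective S i j ∧ L = curve S i j := by
  constructor
  · rintro ⟨x, rfl, hx⟩
    obtain ⟨i, j, hij, hker⟩ := exists_lieStab_eq_ker hx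
    have hfix : ¬ IsTFixed x := by
      intro hfix
      have htop : lieStab x = ⊤ := eq_top_iff.2 fun Y _ s => hfix _
      rw [htop, finrank_top] at hx
      omega
    obtain ⟨S, k, c, hk, hc, rfl⟩ :=
      (isHomogeneousAwayFrom_of_lieStab hker).exists_eq_oneParam_smul hij hfix
    exact ⟨S, i, j, (isEffective_iff S i j).2 ⟨hij, k, hk⟩, (curve_eq_orbit hij hk hc).symm⟩
  · rintro ⟨S, i, j, h, rfl⟩
    obtain ⟨hij, k, hk⟩ := (isEffective_iff S i j).1 h
    exact isOneDimOrbit_curve hij hk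

theorem Admissible.S_injective : Function.Injective (Admissible.S : Admissible n → _) := by
  rintro ⟨S, _, _⟩ ⟨S', _, _⟩ h
  cases h
  rfl

theorem finite_isOneDimOrbit : {L : Set (DegFlag n) | IsOneDimOrbit L}.Finite := by
  have : Finite (Admissible n) := Finite.of_injective _ Admissible.S_injective
  refine (Set.finite_range fun q : Admissible n × Fin (2 * n) × Fin (2 * n) =>
    curve q.1 q.2.1 q.2.2).subset ?_
  intro L hL
  obtain ⟨S, i, j, -, rfl⟩ := (isOneDimOrbit_iff L).1 hL
  exact ⟨(S, i, j), rfl⟩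

/-! ### The Zariski closure -/

theorem frames_nonempty (x : DegFlag n) : (frames x).Nonempty := by
  let b := fun k => Module.finBasisOfFinrankEq ℂ (x.V k) (x.finrank_eq k)
  refine ⟨fun s => (b s.1 s.2.2 : W n) s.2.1, fun k => ?_⟩
  have h := congrArg (Submodule.map (x.V k).subtype) (b k).span_eq
  rw [Submodule.map_span, ← Set.range_comp, Submodule.map_subtype_top] at h
  exact h

theorem sum_smul_column_mem {x : DegFlag n} {B : FrameIdx n → ℂ} (hB : B ∈ frames x) (k : Fin n)
    (u : Fin ((k : ℕ) + 1) → ℂ) : (fun a => ∑ q, B ⟨k, a, q⟩ * u q : W n) ∈ x.V k := by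
  have h : (fun a => ∑ q, B ⟨k, a, q⟩ * u q : W n) =
      ∑ q, u q • (fun a => B ⟨k, a, q⟩ : W n) := by
    funext a
    simp [mul_comm]
  rw [h, ← hB k]
  exact Submodule.sum_mem _ fun q _ => Submodule.smul_mem _ _ (Submodule.subset_span ⟨q, rfl⟩)

theorem exists_eq_sum_smul_column {x : DegFlag n} {B : FrameIdx n → ℂ} (hB : B ∈ frames x)
    {k : Fin n} {v : W n} (hv : v ∈ x.V k) :
    ∃ u : Fin ((k : ℕ) + 1) → ℂ, v = fun a => ∑ q, B ⟨k, a, q⟩ * u q := by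
  rw [← hB k, Submodule.mem_span_range_iff_exists_fun] at hv
  obtain ⟨u, rfl⟩ := hv
  refine ⟨u, ?_⟩
  funext a
  simp [mul_comm]

theorem linearIndependent_columns {x : DegFlag n} {B : FrameIdx n → ℂ} (hB : B ∈ frames x)
    (k : Fin n) : LinearIndependent ℂ fun q : Fin ((k : ℕ) + 1) => (fun a => B ⟨k, a, q⟩ : W n) := by
  rw [linearIndependent_iff_card_eq_finrank_span, Set.finrank, hB k, x.finrank_eq, Fintype.card_fin]

/-- A maximal minor of the frame of `V_k` vanishes if and only if some non-zero vector of `V_k` has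
zero coordinates in the corresponding rows. -/
theorem det_frame_eq_zero_iff {x : DegFlag n} {B : FrameIdx n → ℂ} (hB : B ∈ frames x) (k : Fin n)
    (r : Fin ((k : ℕ) + 1) → Fin (n + 1)) :
    (Matrix.of fun p q => B ⟨k, r p, q⟩).det = 0 ↔
      ∃ v ∈ x.V k, v ≠ 0 ∧ ∀ p, v (r p) = 0 := by
  rw [← Matrix.exists_mulVec_eq_zero_iff]
  constructor
  · rintro ⟨u, hu, h⟩
    refine ⟨_, sum_smul_column_mem hB k u, fun h0 => hu ?_, fun p => congrFun h p⟩
    have hli := Fintype.linearIndependent_iff.1 (linearIndependent_columns hB k) u (by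
      rw [← h0]
      funext a
      simp [mul_comm])
    exact funext hli
  · rintro ⟨v, hv, hv0, h⟩
    obtain ⟨u, rfl⟩ := exists_eq_sum_smul_column hB hv
    refine ⟨u, fun h0 => hv0 ?_, funext h⟩
    funext a
    simp [h0]

theorem mem_zariskiClosure_iff (L : Set (DegFlag n)) (x : DegFlag n) :
    x ∈ zariskiClosure L ↔ ∀ B ∈ frames x, ∀ f : MvPolynomial (FrameIdx n) ℂ,
      (∀ y ∈ L, ∀ C ∈ frames y, MvPolynomial.aeval C f = 0) → MvPolynomial.aeval B f = 0 := by
  change (∀ B, B ∈ frames x → B ∈ MvPolynomial.zeroLocus ℂ _) ↔ _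
  simp only [MvPolynomial.mem_zeroLocus_iff, MvPolynomial.mem_vanishingIdeal_iff, Set.mem_iUnion]
  constructor
  · intro h B hB f hf
    refine h B hB f ?_
    rintro C ⟨y, hy, hC⟩
    exact hf y hy C hC
  · intro h B hB f hf
    exact h B hB f fun y hy C hC => hf C ⟨y, hy, hC⟩

theorem subset_zariskiClosure (L : Set (DegFlag n)) : L ⊆ zariskiClosure L := by
  intro x hx
  rw [mem_zariskiClosure_iff]
  exact fun B hB f hf => hf x hx B hB

/-- The vanishing of a coordinate on `V_k` is a closed condition. -/
theorem coord_eq_zero_of_mem_zariskiClosure {L : Set (DegFlag n)} {k : Fin n} {e : Fin (n + 1)}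
    (h : ∀ y ∈ L, ∀ v ∈ y.V k, v e = 0) {x : DegFlag n} (hx : x ∈ zariskiClosure L) :
    ∀ v ∈ x.V k, v e = 0 := by
  intro v hv
  obtain ⟨B, hB⟩ := frames_nonempty x
  obtain ⟨u, rfl⟩ := exists_eq_sum_smul_column hB hv
  refine Finset.sum_eq_zero fun q _ => ?_
  have hq : B ⟨k, e, q⟩ = 0 := by
    have := (mem_zariskiClosure_iff L x).1 hx B hB (MvPolynomial.X ⟨k, e, q⟩) fun y hy C hC => by
      rw [MvPolynomial.aeval_X]
      refine h y hy (fun a => C ⟨k, a, q⟩) ?_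
      rw [← hC k]
      exact Submodule.subset_span ⟨q, rfl⟩
    rwa [MvPolynomial.aeval_X] at this
  rw [hq, zero_mul]

/-- It is a closed condition that `V_k` contains a non-zero vector whose coordinates in `dim V_k`
given rows are zero: it is the vanishing of a maximal minor. -/
theorem exists_ne_zero_of_mem_zariskiClosure {L : Set (DegFlag n)} {k : Fin n}
    (r : Fin ((k : ℕ) + 1) → Fin (n + 1))
    (h : ∀ y ∈ L, ∃ v ∈ y.V k, v ≠ 0 ∧ ∀ p, v (r p) = 0) {x : DegFlag n}
    (hx : x ∈ zariskiClosure L) : ∃ v ∈ x.V k, v ≠ 0 ∧ ∀ p, v (r p) = 0 := by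
  obtain ⟨B, hB⟩ := frames_nonempty x
  have hdet : ∀ C : FrameIdx n → ℂ, MvPolynomial.aeval C
      (Matrix.of fun p q => (MvPolynomial.X ⟨k, r p, q⟩ : MvPolynomial (FrameIdx n) ℂ)).det =
      (Matrix.of fun p q => C ⟨k, r p, q⟩).det := by
    intro C
    rw [AlgHom.map_det]
    congr 1
    ext p q
    simp
  rw [← det_frame_eq_zero_iff hB k r, ← hdet]
  refine (mem_zariskiClosure_iff L x).1 hx B hB _ fun y hy C hC => ?_
  rw [hdet, det_frame_eq_zero_iff hC k r]
  exact h y hy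

/-- A polynomial that vanishes on a punctured line vanishes at the puncture. -/
theorem aeval_eq_zero_of_punctured_line {σ : Type*} (f : MvPolynomial σ ℂ) (B D : σ → ℂ)
    (h : ∀ c : ℂ, c ≠ 0 → MvPolynomial.aeval (fun s => B s + c * D s) f = 0) :
    MvPolynomial.aeval B f = 0 := by
  let P : Polynomial ℂ :=
    MvPolynomial.aeval (fun s => Polynomial.C (B s) + Polynomial.X * Polynomial.C (D s)) f
  have hP : ∀ c : ℂ, P.eval c = MvPolynomial.aeval (fun s => B s + c * D s) f := by
    intro c
    rw [← Polynomial.coe_aeval_eq_eval]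
    change Polynomial.aeval c (MvPolynomial.aeval _ f) = _
    rw [← AlgHom.comp_apply, MvPolynomial.comp_aeval]
    simp only [map_add, map_mul, Polynomial.aeval_C, Polynomial.aeval_X,
      Algebra.algebraMap_self_apply]
  have h0 : P = 0 := by
    refine Polynomial.eq_zero_of_infinite_isRoot P (Set.Infinite.mono ?_
      (Set.finite_singleton (0 : ℂ)).infinite_compl)
    intro c hc
    exact (hP c).trans (h c hc)
  have h1 := hP 0
  rw [h0, Polynomial.eval_zero] at h1
  simpa using h1.symm

theorem map_mem_frames {x y : DegFlag n} {B : FrameIdx n → ℂ} (hB : B ∈ frames x)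
    (g : Fin n → W n ≃ₗ[ℂ] W n)
    (h : ∀ k, (x.V k).map (g k : W n →ₗ[ℂ] W n) ≤ y.V k) :
    (fun s => g s.1 (fun a => B ⟨s.1, a, s.2.2⟩) s.2.1) ∈ frames y := by
  intro k
  have hk : (x.V k).map (g k : W n →ₗ[ℂ] W n) = y.V k :=
    Submodule.eq_of_le_of_finrank_eq (h k) (by
      rw [LinearEquiv.finrank_map_eq, x.finrank_eq, y.finrank_eq])
  rw [← hk, ← hB k, Submodule.map_span, ← Set.range_comp]
  rfl

/-- If the points `y_c`, `c ≠ 0`, are obtained from `x` by the linear maps `1 + c N_k`, then `x` lies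
in the closure of the set of the `y_c`. -/
theorem mem_zariskiClosure_of_line {L : Set (DegFlag n)} {x : DegFlag n}
    (N : Fin n → Module.End ℂ (W n))
    (h : ∀ c : ℂ, c ≠ 0 → ∃ y ∈ L, ∃ g : Fin n → W n ≃ₗ[ℂ] W n,
      (∀ k v, g k v = v + c • N k v) ∧ ∀ k, ∀ v ∈ x.V k, g k v ∈ y.V k) :
    x ∈ zariskiClosure L := by
  rw [mem_zariskiClosure_iff]
  intro B hB f hf
  refine aeval_eq_zero_of_punctured_line f B
    (fun s => N s.1 (fun a => B ⟨s.1, a, s.2.2⟩) s.2.1) fun c hc => ?_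
  obtain ⟨y, hy, g, hg, hgy⟩ := h c hc
  have hmem := hf y hy _ (map_mem_frames (y := y) hB g fun k => by
    rintro _ ⟨v, hv, rfl⟩
    exact hgy k v hv)
  simpa [hg] using hmem

/-! ### The closure of the curve of an effective pair -/

theorem oneParam_smul_V_of_not_moved {S : Admissible n} {i j : Fin (2 * n)} (hij : i < j) {k : Fin n}
    (hk : ¬ S.Moved i j k) (c : ℂ) : (oneParam hij c • S.p).V k = S.p.V k := by
  symm
  refine Submodule.eq_of_le_of_finrank_eq (fun v hv => ?_) (by
    rw [DegFlag.finrank_eq, DegFlag.finrank_eq])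
  rw [S.mem_p_iff] at hv
  rw [mem_oneParam_smul_iff]
  intro b hb
  by_cases ha : Alive i k ∧ Alive j k
  · rw [elem_apply ha]
    by_cases hi : ind i ∈ S.S k
    · have hbj : b ≠ ind j := by
        rintro rfl
        exact hk ⟨ha, hi, hb⟩
      simp [w_apply, hbj, hv b hb]
    · simp [hv b hb, hv _ hi]
  · simp [elem_of_not ha, hv b hb]

namespace Admissible

open Classical in
/-- The sets of the other end point of the curve of `(i, j)` at `p_S`: at the moved vertices, the
basis vector of `R_i` is replaced by that of `R_j`. -/
def exchangeSet (S : Admissible n) (i j : Fin (2 * n)) (k : Fin n) : Finset (Fin (n + 1)) :=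
  if S.Moved i j k then insert (ind j) ((S.S k).erase (ind i)) else S.S k

variable {S : Admissible n} {i j : Fin (2 * n)}

theorem exchangeSet_of_moved {k : Fin n} (hk : S.Moved i j k) :
    S.exchangeSet i j k = insert (ind j) ((S.S k).erase (ind i)) := by
  simp [exchangeSet, hk]

theorem exchangeSet_of_not_moved {k : Fin n} (hk : ¬ S.Moved i j k) :
    S.exchangeSet i j k = S.S k := by
  simp [exchangeSet, hk]

theorem card_exchangeSet (k : Fin n) : (S.exchangeSet i j k).card = (k : ℕ) + 1 := by
  by_cases hk : S.Moved i j k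
  · rw [exchangeSet_of_moved hk, Finset.card_insert_of_notMem
      (fun h => hk.2.2 (Finset.mem_of_mem_erase h)), Finset.card_erase_of_mem hk.2.1, S.card_eq]
    rfl
  · rw [exchangeSet_of_not_moved hk, S.card_eq]

theorem exchangeSet_subset (hij : i < j) {k l : Fin n} (hkl : (l : ℕ) = (k : ℕ) + 1) :
    S.exchangeSet i j k ⊆ S.exchangeSet i j l ∪ {l.castSucc} := by
  intro e he
  rw [Finset.mem_union, Finset.mem_singleton]
  by_cases hel : e = l.castSucc
  · exact Or.inr hel
  refine Or.inl ?_
  have hsub : ∀ {a}, a ∈ S.S k → a ≠ l.castSucc → a ∈ S.S l := by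
    intro a ha hal
    simpa [hal] using S.subset k l hkl ha
  -- a vertex after an unmoved vertex that contains the basis vector of `R_i` is not moved
  have hstep : ∀ h : S.Moved i j l, ind i ∈ S.S k → ind i ≠ l.castSucc → S.Moved i j k := by
    intro h hi hil
    have hak : Alive i k ∧ Alive j k := by
      by_contra hak
      exact hil (ind_left_eq hij hkl h.1.1 h.1.2 hak)
    exact ⟨hak, hi, fun hj => h.2.2 (hsub hj (ind_ne_castSucc hkl hak.2 h.1.2))⟩
  by_cases hk : S.Moved i j k
  · rw [exchangeSet_of_moved hk, Finset.mem_insert, Finset.mem_erase] at he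
    rcases he with rfl | ⟨hei, he⟩
    · have hal : Alive i l ∧ Alive j l := by
        by_contra hal
        exact hel (ind_right_eq hij hkl hk.1.1 hk.1.2 hal)
      by_cases hl : S.Moved i j l
      · rw [exchangeSet_of_moved hl]
        exact Finset.mem_insert_self _ _
      · rw [exchangeSet_of_not_moved hl]
        by_contra hj
        exact hl ⟨hal, hsub hk.2.1 (ind_ne_castSucc hkl hk.1.1 hal.1), hj⟩
    · by_cases hl : S.Moved i j l
      · rw [exchangeSet_of_moved hl]
        exact Finset.mem_insert_of_mem (Finset.mem_erase.2 ⟨hei, hsub he hel⟩)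
      · rw [exchangeSet_of_not_moved hl]
        exact hsub he hel
  · rw [exchangeSet_of_not_moved hk] at he
    by_cases hl : S.Moved i j l
    · rw [exchangeSet_of_moved hl]
      refine Finset.mem_insert_of_mem (Finset.mem_erase.2 ⟨?_, hsub he hel⟩)
      rintro rfl
      exact hk (hstep hl he hel)
    · rw [exchangeSet_of_not_moved hl]
      exact hsub he hel

/-- The admissible collection of the other end point of the curve of `(i, j)` at `p_S`. -/
def exchange (S : Admissible n) {i j : Fin (2 * n)} (hij : i < j) : Admissible n where
  S := S.exchangeSet i j
  card_eq := card_exchangeSet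
  subset _ _ := exchangeSet_subset hij

theorem ind_right_mem_exchange (hij : i < j) {k : Fin n} (hk : S.Moved i j k) :
    ind j ∈ (S.exchange hij).S k := by
  change ind j ∈ S.exchangeSet i j k
  rw [exchangeSet_of_moved hk]
  exact Finset.mem_insert_self _ _

theorem exchange_p_V_of_not_moved (hij : i < j) {k : Fin n} (hk : ¬ S.Moved i j k) :
    (S.exchange hij).p.V k = S.p.V k := by
  ext v
  rw [mem_p_iff, mem_p_iff]
  change (∀ b, b ∉ S.exchangeSet i j k → _) ↔ _
  rw [exchangeSet_of_not_moved hk]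

end Admissible

variable {S : Admissible n} {i j : Fin (2 * n)}

theorem p_mem_closure_curve (hij : i < j) {k₀ : Fin n} (hk₀ : S.Moved i j k₀) :
    S.p ∈ zariskiClosure (curve S i j) := by
  refine mem_zariskiClosure_of_line (elem i j) fun c hc => ⟨oneParam hij c • S.p, ?_,
    fun k => shear hij.ne k c, fun k v => rfl, fun k v hv => ⟨v, hv, rfl⟩⟩
  rw [curve_eq hij hk₀]
  exact ⟨c, hc, rfl⟩

open Classical in
/-- The transvection of the plane `R_i ⊕ R_j` in the opposite direction takes the other end point of
the curve to the point with the inverse parameter. -/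
theorem exchange_p_mem_closure_curve (hij : i < j) {k₀ : Fin n} (hk₀ : S.Moved i j k₀) :
    (S.exchange hij).p ∈ zariskiClosure (curve S i j) := by
  refine mem_zariskiClosure_of_line (fun k => if S.Moved i j k then elem j i k else 0) fun c hc =>
    ⟨oneParam hij c⁻¹ • S.p, ?_, fun k => if S.Moved i j k then shear hij.ne' k c else
      LinearEquiv.refl ℂ _, fun k v => ?_, fun k v hv => ?_⟩
  · rw [curve_eq hij hk₀]
    exact ⟨_, inv_ne_zero hc, rfl⟩
  · beta_reduce
    split_ifs
    · rfl
    · simp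
  · beta_reduce
    split_ifs with hk
    · rw [Admissible.mem_p_iff] at hv
      change ∀ b, b ∉ S.exchangeSet i j k → _ at hv
      rw [Admissible.exchangeSet_of_moved hk] at hv
      have hne := ind_ne hij.ne hk.1.1 hk.1.2
      rw [mem_oneParam_smul_iff]
      intro b hb
      rw [shear_apply, elem_apply hk.1, elem_apply hk.1.symm]
      have hvi : v (ind i) = 0 := hv _ (by simp [hne])
      have hbi : b ≠ ind i := fun e => hb (e ▸ hk.2.1)
      by_cases hbj : b = ind j
      · subst hbj
        simp [w_apply, hne.symm, hvi, hc]
      · have hvb : v b = 0 := hv b (by simp [hbj, hb])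
        simp [w_apply, hbi, hbj, hvb]
    · rw [oneParam_smul_V_of_not_moved hij hk, ← Admissible.exchange_p_V_of_not_moved hij hk]
      exact hv

theorem coord_eq_zero_of_mem_closure_curve (hij : i < j) {k₀ : Fin n} (hk₀ : S.Moved i j k₀)
    {x : DegFlag n} (hx : x ∈ zariskiClosure (curve S i j)) {k : Fin n} {v : W n} (hv : v ∈ x.V k)
    {e : Fin (n + 1)} (he : e ∉ S.S k) (hej : ¬ (S.Moved i j k ∧ e = ind j)) : v e = 0 := by
  refine coord_eq_zero_of_mem_zariskiClosure ?_ hx v hv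
  intro y hy v hv
  rw [curve_eq hij hk₀] at hy
  obtain ⟨c, -, rfl⟩ := hy
  by_cases hk : S.Moved i j k
  · rw [mem_oneParam_smul_iff] at hv
    have h := hv e he
    rw [elem_apply hk.1] at h
    have hne : e ≠ ind j := fun h => hej ⟨hk, h⟩
    simpa [w_apply, hne] using h
  · rw [oneParam_smul_V_of_not_moved hij hk, S.mem_p_iff] at hv
    exact hv e he

theorem V_eq_of_mem_closure_curve_of_not_moved (hij : i < j) {k₀ : Fin n} (hk₀ : S.Moved i j k₀)
    {x : DegFlag n} (hx : x ∈ zariskiClosure (curve S i j)) {k : Fin n} (hk : ¬ S.Moved i j k) :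
    x.V k = S.p.V k := by
  refine Submodule.eq_of_le_of_finrank_eq (fun v hv => ?_) (by
    rw [DegFlag.finrank_eq, DegFlag.finrank_eq])
  rw [S.mem_p_iff]
  exact fun b hb => coord_eq_zero_of_mem_closure_curve hij hk₀ hx hv hb fun h => hk h.1

theorem w_mem_of_mem_closure_curve (hij : i < j) {k₀ : Fin n} (hk₀ : S.Moved i j k₀)
    {x : DegFlag n} (hx : x ∈ zariskiClosure (curve S i j)) {k : Fin n} (hk : S.Moved i j k)
    {e : Fin (n + 1)} (he : e ∈ S.S k) (hei : e ≠ ind i) : (w e : W n) ∈ x.V k := by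
  have hej : ind j ≠ e := fun h => hk.2.2 (h ▸ he)
  -- the rows are the indices in `S_k ∪ {ind j}` other than `e`
  let σ := (S.S k).equivFinOfCardEq (S.card_eq k)
  let r : Fin ((k : ℕ) + 1) → Fin (n + 1) := fun p =>
    if (σ.symm p : Fin (n + 1)) = e then ind j else σ.symm p
  have hr : ∀ p, r p ≠ e := by
    intro p
    simp only [r]
    split_ifs with h
    · exact hej
    · exact h
  obtain ⟨v, hv, hv0, hvr⟩ := exists_ne_zero_of_mem_zariskiClosure (k := k) r (by
    intro y hy
    rw [curve_eq hij hk₀] at hy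
    obtain ⟨c, -, rfl⟩ := hy
    refine ⟨w e, ?_, linearIndependent_w.ne_zero _, fun p => by simp [w_apply, hr p]⟩
    rw [mem_oneParam_smul_iff]
    intro b hb
    have hbe : b ≠ e := fun h => hb (h ▸ he)
    simp [elem_apply hk.1, w_apply, hbe, hei.symm]) hx
  have hve : v = v e • w e := by
    refine eq_smul_w fun b hb => ?_
    by_cases hbS : b ∈ S.S k
    · have := hvr (σ ⟨b, hbS⟩)
      simpa [r, hb] using this
    · by_cases hbj : b = ind j
      · have := hvr (σ ⟨e, he⟩)
        simpa [r, hbj] using this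
      · exact coord_eq_zero_of_mem_closure_curve hij hk₀ hx hv hbS fun h => hbj h.2
  have hne : v e ≠ 0 := by
    intro h0
    rw [h0, zero_smul] at hve
    exact hv0 hve
  rw [hve] at hv
  exact (Submodule.smul_mem_iff _ hne).1 hv

theorem isHomogeneousAwayFrom_of_mem_closure_curve (hij : i < j) {k₀ : Fin n}
    (hk₀ : S.Moved i j k₀) {x : DegFlag n} (hx : x ∈ zariskiClosure (curve S i j)) :
    IsHomogeneousAwayFrom i j x := by
  intro k v hv a hai haj
  by_cases hk : S.Moved i j k
  · by_cases ha : a ∈ S.S k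
    · exact Submodule.smul_mem _ _ (w_mem_of_mem_closure_curve hij hk₀ hx hk ha
        fun h => hai (h ▸ hk.1.1))
    · rw [coord_eq_zero_of_mem_closure_curve hij hk₀ hx hv ha fun h => haj (h.2 ▸ hk.1.2), zero_smul]
      exact Submodule.zero_mem _
  · rw [V_eq_of_mem_closure_curve_of_not_moved hij hk₀ hx hk, S.mem_p_iff] at hv ⊢
    intro b hb
    by_cases hba : b = a
    · subst hba
      simp [hv b hb]
    · simp [w_apply, hba]

/-- For dimension reasons, the space of a point of the closure at a moved vertex is not contained in
the span of the fixed basis vectors. -/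
theorem exists_mem_of_mem_closure_curve (hij : i < j) {k₀ : Fin n}
    (hk₀ : S.Moved i j k₀) {x : DegFlag n} (hx : x ∈ zariskiClosure (curve S i j)) {k : Fin n}
    (hk : S.Moved i j k) : ∃ v ∈ x.V k, v (ind i) ≠ 0 ∨ v (ind j) ≠ 0 := by
  by_contra! hcon
  have hle : x.V k ≤ Submodule.span ℂ (w '' ((S.S k).erase (ind i) : Set (Fin (n + 1)))) := by
    intro v hv
    rw [mem_span_w_iff]
    intro b hb
    rw [Finset.mem_coe, Finset.mem_erase, not_and] at hb
    by_cases hbi : b = ind i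
    · rw [hbi, (hcon v hv).1]
    · by_cases hbj : b = ind j
      · rw [hbj, (hcon v hv).2]
      · exact coord_eq_zero_of_mem_closure_curve hij hk₀ hx hv (hb hbi) fun h => hbj h.2
  have h := Submodule.finrank_mono hle
  rw [finrank_span_w, x.finrank_eq, Finset.card_erase_of_mem hk.2.1, S.card_eq] at h
  omega

theorem zariskiClosure_curve (hij : i < j) {k₀ : Fin n} (hk₀ : S.Moved i j k₀) :
    zariskiClosure (curve S i j) = curve S i j ∪ {S.p, (S.exchange hij).p} := by
  apply Set.Subset.antisymm
  · intro x hx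
    have hhom := isHomogeneousAwayFrom_of_mem_closure_curve hij hk₀ hx
    by_cases hall : ∀ k, S.Moved i j k → (w (ind j) : W n) ∈ x.V k
    · have hq : x = (S.exchange hij).p := by
        symm
        apply DegFlag.eq_of_le
        intro k
        by_cases hk : S.Moved i j k
        · change Submodule.span ℂ (w '' (S.exchangeSet i j k : Set (Fin (n + 1)))) ≤ _
          rw [Submodule.span_le]
          rintro _ ⟨e, he, rfl⟩
          rw [Finset.mem_coe, Admissible.exchangeSet_of_moved hk, Finset.mem_insert,
            Finset.mem_erase] at he
          rcases he with rfl | ⟨hei, he⟩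
          · exact hall k hk
          · exact w_mem_of_mem_closure_curve hij hk₀ hx hk he hei
        · rw [Admissible.exchange_p_V_of_not_moved hij hk,
            V_eq_of_mem_closure_curve_of_not_moved hij hk₀ hx hk]
      simp [hq]
    · push Not at hall
      obtain ⟨k₁, hk₁, hj⟩ := hall
      obtain ⟨v, hv, hvij⟩ := exists_mem_of_mem_closure_curve hij hk₀ hx hk₁
      have hp := hhom.pair_mem hij.ne hk₁.1 hv
      have hvi : v (ind i) ≠ 0 := by
        intro h0
        rw [h0, zero_smul, zero_add] at hp
        exact hj ((Submodule.smul_mem_iff _ (by tauto)).1 hp)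
      have hz : w (ind i) + (v (ind j) / v (ind i)) • w (ind j) ∈ x.V k₁ := by
        have := Submodule.smul_mem _ (v (ind i))⁻¹ hp
        rwa [smul_add, smul_smul, smul_smul, inv_mul_cancel₀ hvi, one_smul, mul_comm,
          ← div_eq_mul_inv] at this
      set c := v (ind j) / v (ind i)
      have hxc : x = oneParam hij c • S.p := by
        symm
        apply DegFlag.eq_of_le
        intro k
        by_cases hk : S.Moved i j k
        · change (Submodule.span ℂ (w '' (S.S k : Set (Fin (n + 1))))).map
            (shear hij.ne k c : W n →ₗ[ℂ] W n) ≤ _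
          rw [Submodule.map_span, Submodule.span_le]
          rintro _ ⟨_, ⟨e, he, rfl⟩, rfl⟩
          change shear hij.ne k c (w e) ∈ x.V k
          rw [shear_apply, elem_apply hk.1]
          by_cases hei : e = ind i
          · obtain ⟨u, hu, huij⟩ := exists_mem_of_mem_closure_curve hij hk₀ hx hk
            subst hei
            rw [w_apply, if_pos rfl, one_smul]
            exact hhom.mixed_vector_mem hij.ne hk₁.1 hz hj hk.1 hu huij
          · rw [w_apply, if_neg (Ne.symm hei), zero_smul, smul_zero, add_zero]
            exact w_mem_of_mem_closure_curve hij hk₀ hx hk he hei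
        · rw [oneParam_smul_V_of_not_moved hij hk,
            V_eq_of_mem_closure_curve_of_not_moved hij hk₀ hx hk]
      by_cases hc : c = 0
      · rw [hc, oneParam_zero_smul] at hxc
        simp [hxc]
      · left
        rw [curve_eq hij hk₀]
        exact ⟨c, hc, hxc⟩
  · rintro x (hx | rfl | rfl)
    · exact subset_zariskiClosure _ hx
    · exact p_mem_closure_curve hij hk₀
    · exact exchange_p_mem_closure_curve hij hk₀

theorem isMomentEdge_curve (hij : i < j) {k₀ : Fin n} (hk₀ : S.Moved i j k₀) :
    IsMomentEdge (curve S i j) S.p (S.exchange hij).p where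
  isOneDimOrbit := isOneDimOrbit_curve hij hk₀
  fixed_left := S.torus_smul_p
  fixed_right := (S.exchange hij).torus_smul_p
  ne h := by
    have h1 := ((S.exchange hij).w_mem_p_iff k₀ _).2 (Admissible.ind_right_mem_exchange hij hk₀)
    rw [← h, S.w_mem_p_iff] at h1
    exact hk₀.2.2 h1
  left_notMem h := h.2 rfl
  right_notMem h := by
    rw [curve_eq hij hk₀] at h
    obtain ⟨c, -, hq⟩ := h
    have h1 := ((S.exchange hij).w_mem_p_iff k₀ _).2 (Admissible.ind_right_mem_exchange hij hk₀)
    rw [hq, mem_oneParam_smul_iff] at h1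
    have h2 := h1 _ hk₀.2.2
    rw [elem_apply hk₀.1] at h2
    simp [w_apply, ind_ne hij.ne hk₀.1.1 hk₀.1.2] at h2
  closure_eq := zariskiClosure_curve hij hk₀

end DegenerateFlag

end

theorem mainTheorem4 (n : ℕ) :
    {L : Set (DegFlag n) | IsOneDimOrbit L}.Finite ∧
    {L : Set (DegFlag n) | IsOneDimOrbit L} =
      {L | ∃ (S : Admissible n) (i j : Fin (2 * n)), IsEffective S i j ∧ L = curve S i j} ∧
    ∀ (S : Admissible n) (i j : Fin (2 * n)), IsEffective S i j →
      (∃ q : DegFlag n, IsMomentEdge (curve S i j) S.p q) ∧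
      IsEdgeLabel (curve S i j) (alpha i j) := by
  refine ⟨finite_isOneDimOrbit, Set.ext fun L => isOneDimOrbit_iff L, fun S i j h => ?_⟩
  obtain ⟨hij, k, hk⟩ := (isEffective_iff S i j).1 h
  exact ⟨⟨_, isMomentEdge_curve hij hk⟩, isEdgeLabel_curve hij hk⟩
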